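/- A tangle diagram $T$ is a finite (tame, i.e. piecewise linear) multigraph embedded in a closed disk, whose vertices are univalent (exactly those on the boundary circle, the boundary points), quadrivalent (crossings, each with one pair of opposite edges marked over and the other pair marked under), or bivalent and lying on a vertex-free simple closed loop. Let $n_T$, $c_T$, $g_T$ be the numbers of crossings, connected components and boundary points of $T$, and let $i_T$ be the number of interior faces, i.e. connected components of the closed disk minus $T$ that do not meet the boundary circle. A base tangle is a tangle diagram without crossings and without loops, considered up to planar isotopy fixing the boundary. Expand $T$ in base tangles with the same boundary points by resolving every crossing as $A\cdot(\text{$A$-smoothing})+A^{-1}\cdot(\text{$A^{-1}$-smoothing})$ and replacing every loop by a factor $\delta$. With $\delta=-A^2-A^{-2}$ this gives the Kauffman bracket $\langle T\rangle=\sum_B P^T_B(A)\,B$, and with $\delta=A^2+A^{-2}$ the positive Kauffman bracket $[T]=\sum_B\overline P^T_B(A)\,B$, where $P^T_B,\overline P^T_B\in\mathbb Z[A,A^{-1}]$. The span of a Laurent polynomial is its highest exponent minus its lowest exponent (and $0$ for the zero polynomial). **Proposition.** For every tangle diagram $T$, $$4\,i_T=4(n_T+c_T)-2g_T,$$ and for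 every base tangle $B$ with the same boundary points as $T$, the spans of $\overline P^T_B$ and of $P^T_B$ are both at most $4\,i_T$. -/

import Mathlib

noncomputable section

/-- A piecewise linear tangle diagram in the closed unit disk of the complex plane: a finite graph
drawn with straight, pairwise non-crossing segments. Vertices on the unit circle are univalent
(boundary points); every other vertex is quadrivalent (a crossing) or bivalent. Bivalent vertices
are bends, so a polygonal path through bends is one edge of the diagram in the usual sense, and a
connected component all of whose vertices are bends is a crossingless loop. -/
structure TangleDiagram where
  /-- the vertices -/
  V : Finset ℂ
  /-- two vertices are adjacent when they are joined by a segment of the diagram -/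
  G : SimpleGraph V
  norm_le : ∀ v : V, ‖(v : ℂ)‖ ≤ 1
  boundary_valence : ∀ v : V, ‖(v : ℂ)‖ = 1 → (G.neighborSet v).ncard = 1
  interior_valence : ∀ v : V, ‖(v : ℂ)‖ < 1 →
    (G.neighborSet v).ncard = 2 ∨ (G.neighborSet v).ncard = 4
  /-- distinct segments meet at most in common endpoints -/
  embedded : ∀ a b c d : V, G.Adj a b → G.Adj c d → s(a, b) ≠ s(c, d) →
    Disjoint (openSegment ℝ (a : ℂ) b) (segment ℝ (c : ℂ) d)
  /-- The four neighbours of each crossing, in counterclockwise order; `0` and `2` lie on the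
  over strand, `1` and `3` on the under strand. -/
  nbr : {x : V // (G.neighborSet x).ncard = 4} → Fin 4 → V
  range_nbr : ∀ x, Set.range (nbr x) = G.neighborSet x.1
  nbr_ccw : ∀ x,
    sbtw (Complex.arg (nbr x 0 - x.1) : Real.Angle) (Complex.arg (nbr x 1 - x.1))
      (Complex.arg (nbr x 2 - x.1)) ∧
    sbtw (Complex.arg (nbr x 2 - x.1) : Real.Angle) (Complex.arg (nbr x 3 - x.1))
      (Complex.arg (nbr x 0 - x.1))

namespace TangleDiagram

variable (D : TangleDiagram)

/-- The crossings. -/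
abbrev Crossing : Type := {x : D.V // (D.G.neighborSet x).ncard = 4}

/-- The set of boundary points (the type of the diagram). -/
def boundary : Set ℂ := {z | z ∈ D.V ∧ ‖z‖ = 1}

/-- The subset of the disk covered by the diagram. -/
def carrier : Set ℂ := {z | ∃ a b : D.V, D.G.Adj a b ∧ z ∈ segment ℝ (a : ℂ) b}

/-- The faces: connected components of the closed disk with the diagram removed. -/
def faces : Set (Set ℂ) :=
  {F | ∃ z ∈ Metric.closedBall (0 : ℂ) 1 \ D.carrier,
    F = connectedComponentIn (Metric.closedBall (0 : ℂ) 1 \ D.carrier) z}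

/-- The interior faces: those that do not touch the boundary circle. -/
def interiorFaces : Set (Set ℂ) := {F ∈ D.faces | Disjoint F (Metric.sphere (0 : ℂ) 1)}

/-- `i_D`, the number of interior faces. -/
def numInteriorFaces : ℕ := D.interiorFaces.ncard

/-- `n_D`, the number of crossings. -/
def numCrossings : ℕ := Nat.card D.Crossing

/-- `c_D`, the number of connected components. -/
def numComponents : ℕ := Nat.card D.G.ConnectedComponent

/-- `g_D`, the number of boundary points. -/
def numBoundary : ℕ := D.boundary.ncard

/-- A base tangle diagram: no crossings and no loops (every component meets the boundary). -/
def IsBase : Prop :=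
  IsEmpty D.Crossing ∧ ∀ v : D.V, ∃ w : D.V, ‖(w : ℂ)‖ = 1 ∧ D.G.Reachable v w

/-- A Kauffman state: `true` is the `A`-smoothing of a crossing and `false` the
`A⁻¹`-smoothing. -/
abbrev State : Type := D.Crossing → Bool

/-- In the state `s`, the smoothed curve passes through the vertex `v` from the segment `v a` to
the segment `v b`. At a bend it just passes through. The `A`-smoothing of a crossing merges the two
regions swept out when the over strand turns counterclockwise, that is, the regions between
neighbours `0`, `1` and between neighbours `2`, `3`; so it joins `1` to `2` and `3` to `0`.
The `A⁻¹`-smoothing joins `0` to `1` and `2` to `3`. -/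
def Passes (s : D.State) (v a b : D.V) : Prop :=
  ((D.G.neighborSet v).ncard = 2 ∧ D.G.Adj v a ∧ D.G.Adj v b) ∨
  ∃ x : D.Crossing, x.1 = v ∧
    ((s x = true ∧ ((a = D.nbr x 1 ∧ b = D.nbr x 2) ∨ (a = D.nbr x 3 ∧ b = D.nbr x 0))) ∨
      (s x = false ∧ ((a = D.nbr x 0 ∧ b = D.nbr x 1) ∨ (a = D.nbr x 2 ∧ b = D.nbr x 3))))

/-- The smoothing of `D` by the state `s`, as a graph whose vertices are the segments of `D`: two
segments are adjacent when they are joined end to end in the smoothed diagram. Its connected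
components are the arcs and the loops of the smoothed diagram. -/
def smoothing (s : D.State) : SimpleGraph D.G.edgeSet :=
  SimpleGraph.fromRel fun e f => ∃ v a b : D.V,
    D.Passes s v a b ∧ (e : Sym2 D.V) = s(v, a) ∧ (f : Sym2 D.V) = s(v, b)

/-- The number of loops of the smoothed diagram: its components without boundary points. -/
def numLoops (s : D.State) : ℕ :=
  Nat.card {K : (D.smoothing s).ConnectedComponent //
    ∀ e : D.G.edgeSet, (D.smoothing s).connectedComponentMk e = K →
      ∀ v : D.V, v ∈ (e : Sym2 D.V) → ‖(v : ℂ)‖ < 1}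

/-- The smoothed diagram contains an arc that connects the boundary points `p` and `q`. -/
def Connects (s : D.State) (p q : ℂ) : Prop :=
  ∃ e f : D.G.edgeSet, (∃ v : D.V, v ∈ (e : Sym2 D.V) ∧ (v : ℂ) = p) ∧
    (∃ w : D.V, w ∈ (f : Sym2 D.V) ∧ (w : ℂ) = q) ∧ (D.smoothing s).Reachable e f

/-- The diagram contains a path between the points `p` and `q`. -/
def Joins (p q : ℂ) : Prop :=
  ∃ v w : D.V, (v : ℂ) = p ∧ (w : ℂ) = q ∧ D.G.Reachable v w

/-- With its loops deleted, the smoothing of `D` by the state `s` is the base tangle `B`. Base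
tangle diagrams with the same boundary points are planar isotopic relative to the boundary exactly
when they connect the same pairs of boundary points. -/
def SmoothsTo (s : D.State) (B : TangleDiagram) : Prop :=
  ∀ p ∈ D.boundary, ∀ q ∈ D.boundary, D.Connects s p q ↔ B.Joins p q

/-- Number of `A`-smoothings minus number of `A⁻¹`-smoothings. -/
def stateExponent (s : D.State) : ℤ :=
  (Nat.card {x : D.Crossing // s x = true} : ℤ) - Nat.card {x : D.Crossing // s x = false}

open Classical in
/-- The coefficient of the base tangle `B` in the expansion of `D` determined by the two skein
relations `crossing = A • (A-smoothing) + A⁻¹ • (A⁻¹-smoothing)` and `loop = δ • (no loop)`: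
the sum of `A ^ (a(s) - b(s)) * δ ^ (number of loops)` over all states `s` that smooth `D` to `B`
and loops. -/
def skeinCoeff (δ : LaurentPolynomial ℤ) (B : TangleDiagram) : LaurentPolynomial ℤ :=
  ∑ s : D.State, if D.SmoothsTo s B then
    LaurentPolynomial.T (D.stateExponent s) * δ ^ D.numLoops s else 0

/-- The coefficient of `B` in the Kauffman bracket `⟨D⟩`; a loop counts `-A² - A⁻²`. -/
def bracketCoeff (B : TangleDiagram) : LaurentPolynomial ℤ :=
  D.skeinCoeff (-LaurentPolynomial.T 2 - LaurentPolynomial.T (-2)) B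

/-- The coefficient of `B` in the positive Kauffman bracket `[D]`; a loop counts `A² + A⁻²`. -/
def posBracketCoeff (B : TangleDiagram) : LaurentPolynomial ℤ :=
  D.skeinCoeff (LaurentPolynomial.T 2 + LaurentPolynomial.T (-2)) B

end TangleDiagram

/-- The span of a Laurent polynomial: highest minus lowest exponent that occurs (`0` for the zero
polynomial). -/
def laurentSpan (p : LaurentPolynomial ℤ) : ℤ :=
  if h : p.coeff.support.Nonempty then p.coeff.support.max' h - p.coeff.support.min' h else 0

end

/-! Faces. The cycle space of the underlying graph has dimension `E - V + c` over every field
(`SimpleGraph.finrank_cycleSpace`). Winding numbers embed the complex cycle space into the functions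
on the interior faces (`finrank_cycleSpace_le_numInteriorFaces`). In the other direction, the jumps
across the edges embed the mod 2 functions on the interior faces into the mod 2 cycle space
(`exists_injective_jump`). Hence `i = E - V + c`, and counting degrees, `2E = 2V + 2n - g`, turns
this into the stated formula.

Span. A state with exponent `a` and `l` loops contributes only exponents between `a - 2l` and `a +
2l`, whichever sign the loop value has. If `s` and `s'` both smooth to `B` and differ at `d`
crossings, their exponents differ by at most `2d`, so the span is bounded once `d + l + l' + g ≤ 2(n
+ c)` is known (`numLoops_add_numLoops_le`).

This last inequality says that a closed surface has Euler characteristic at most twice its number of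
components. Close up both smoothings outside the disk by the arcs they share. The two resulting
matchings of darts, together with dart reversal, are three fixed-point free involutions, that is, a
cubic graph with coloured edges; gluing disks to its two-coloured cycles gives the surface. The
proof replaces topology by linear algebra over `ZMod 2`: orbits are counted by dimensions of spaces
of invariant functions, and `finrank_invariantFunctions_three` follows because functions invariant
under a common fixed-point free involution are orthogonal. -/

/-! ### Involutions of a finite set and their invariant functions mod 2 -/

noncomputable section

open Module

/-- The functions to `ZMod 2` invariant under a self-map. -/
def invariantFunctions {X : Type*} (a : X → X) : Submodule (ZMod 2) (X → ZMod 2) where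
  carrier := {f | ∀ x, f (a x) = f x}
  add_mem' := fun hf hg x => by simp [hf x, hg x]
  zero_mem' := fun x => rfl
  smul_mem' := fun c f hf x => by simp [hf x]

theorem zmod_two_add_self (x : ZMod 2) : x + x = 0 := CharTwo.add_self_eq_zero x

/-- The terms at `x` and `a x` are equal, so they cancel in characteristic 2; without fixed points
every term is cancelled. -/
theorem invariantFunctions_isotropic {X : Type*} [Fintype X] {a : X → X}
    (ha : Function.Involutive a) (ha' : ∀ x, a x ≠ x) {f g : X → ZMod 2}
    (hf : f ∈ invariantFunctions a) (hg : g ∈ invariantFunctions a) : f ⬝ᵥ g = 0 := by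
  unfold dotProduct
  refine Finset.sum_involution (fun x _ => a x) ?_ ?_ ?_ ?_
  · intro x _
    rw [hf x, hg x, zmod_two_add_self]
  · intro x _ _
    exact ha' x
  · intro x _
    exact Finset.mem_univ _
  · intro x _
    exact ha x

/-- In characteristic 2 the map `φ = a* + 1` has square zero. Its kernel and its range both consist
of invariant functions, and rank-nullity gives the bound. -/
theorem card_le_two_mul_finrank_invariantFunctions {X : Type*} [Fintype X] {a : X → X}
    (ha : Function.Involutive a) :
    Fintype.card X ≤ 2 * finrank (ZMod 2) (invariantFunctions a) := by
  let φ : (X → ZMod 2) →ₗ[ZMod 2] (X → ZMod 2) := LinearMap.funLeft (ZMod 2) (ZMod 2) a + LinearMap.id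
  have hφ : ∀ f x, φ f x = f (a x) + f x := fun f x => rfl
  have h1 : LinearMap.ker φ ≤ invariantFunctions a := by
    intro f hf x
    have := congrFun (LinearMap.mem_ker.1 hf) x
    rw [hφ] at this
    exact CharTwo.add_eq_zero.1 this
  have h2 : LinearMap.range φ ≤ invariantFunctions a := by
    rintro _ ⟨f, rfl⟩ x
    rw [hφ, hφ, ha x, add_comm]
  have h3 := LinearMap.finrank_range_add_finrank_ker φ
  rw [finrank_fintype_fun_eq_card] at h3
  have h4 := Submodule.finrank_mono h1
  have h5 := Submodule.finrank_mono h2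
  omega

theorem finrank_add_finrank_le_of_dotProduct_eq_zero {K X : Type*} [Field K] [Fintype X]
    (P Q : Submodule K (X → K)) (h : ∀ f ∈ P, ∀ g ∈ Q, f ⬝ᵥ g = 0) :
    finrank K P + finrank K Q ≤ Fintype.card X := by
  classical
  let B : LinearMap.BilinForm K (X → K) := dotProductBilin K K
  have hB : B.ker = ⊥ := by
    rw [LinearMap.ker_eq_bot']
    intro f hf
    refine dotProduct_eq_zero f fun w => ?_
    exact LinearMap.congr_fun hf w
  have h1 := LinearMap.BilinForm.finrank_add_finrank_orthogonal' (B := B) P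
  have h2 : Q ≤ B.orthogonal P := fun g hg f hf => h f hf g hg
  have h3 := Submodule.finrank_mono h2
  rw [hB, inf_bot_eq, finrank_bot, finrank_fintype_fun_eq_card] at h1
  omega

/-- Three fixed-point free involutions on a finite set generate orbits whose numbers satisfy the
Euler characteristic inequality of the closed surface with the corresponding edge-coloured cubic
graph; stated for dimensions of spaces of invariant functions. -/
theorem finrank_invariantFunctions_three {X : Type*} [Fintype X] {a b c : X → X}
    (ha : Function.Involutive a) (hb : Function.Involutive b) (hc : Function.Involutive c)
    (ha' : ∀ x, a x ≠ x) (hb' : ∀ x, b x ≠ x) (hc' : ∀ x, c x ≠ x) :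
    2 * (finrank (ZMod 2) ↥(invariantFunctions a ⊓ invariantFunctions b) +
      finrank (ZMod 2) ↥(invariantFunctions a ⊓ invariantFunctions c) +
      finrank (ZMod 2) ↥(invariantFunctions b ⊓ invariantFunctions c)) ≤
    Fintype.card X + 4 * finrank (ZMod 2)
      ↥(invariantFunctions a ⊓ invariantFunctions b ⊓ invariantFunctions c) := by
  set A := invariantFunctions a with hA
  set B := invariantFunctions b with hB
  set C := invariantFunctions c with hC
  have h1 := Submodule.finrank_sup_add_finrank_inf_eq (A ⊓ B) (A ⊓ C)
  have h2 := Submodule.finrank_sup_add_finrank_inf_eq A (B ⊓ C)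
  have e1 : (A ⊓ B) ⊓ (A ⊓ C) = A ⊓ B ⊓ C := by
    ext; simp only [Submodule.mem_inf]; tauto
  have e2 : A ⊓ (B ⊓ C) = A ⊓ B ⊓ C := inf_assoc .. |>.symm
  rw [e1] at h1
  rw [e2] at h2
  have h3 : _ ≤ 2 * finrank (ZMod 2) A := card_le_two_mul_finrank_invariantFunctions ha
  -- Any summand of `A ⊓ B ⊔ A ⊓ C` and any summand of `A ⊔ B ⊓ C` lie in a common one of `A`, `B`,
  -- `C`, so they are orthogonal.
  have h4 := finrank_add_finrank_le_of_dotProduct_eq_zero (A ⊓ B ⊔ A ⊓ C) (A ⊔ B ⊓ C) (by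
    intro f hf g hg
    obtain ⟨f1, hf1, f2, hf2, rfl⟩ := Submodule.mem_sup.1 hf
    obtain ⟨g1, hg1, g2, hg2, rfl⟩ := Submodule.mem_sup.1 hg
    rw [add_dotProduct, dotProduct_add, dotProduct_add,
      invariantFunctions_isotropic ha ha' hf1.1 hg1, invariantFunctions_isotropic ha ha' hf2.1 hg1,
      invariantFunctions_isotropic hb hb' hf1.2 hg2.1,
      invariantFunctions_isotropic hc hc' hf2.2 hg2.2]
    simp)
  omega

/-- Imposing `m` linear equations lowers the dimension by at most `m`. -/
theorem finrank_le_finrank_inf_ker_add {K W ι : Type*} [Field K] [AddCommGroup W] [Module K W]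
    [FiniteDimensional K W] [Fintype ι] (A : Submodule K W) (φ : W →ₗ[K] (ι → K)) :
    finrank K A ≤ finrank K ↥(A ⊓ LinearMap.ker φ) + Fintype.card ι := by
  have h1 := LinearMap.finrank_range_add_finrank_ker (φ.domRestrict A)
  have h2 : finrank K (LinearMap.range (φ.domRestrict A)) ≤ Fintype.card ι := by
    rw [← finrank_fintype_fun_eq_card K (η := ι)]
    exact Submodule.finrank_le _
  have h3 : finrank K (LinearMap.ker (φ.domRestrict A)) ≤ finrank K ↥(A ⊓ LinearMap.ker φ) := by
    have : (LinearMap.ker (φ.domRestrict A)).map A.subtype ≤ A ⊓ LinearMap.ker φ := by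
      rintro _ ⟨⟨x, hx⟩, h, rfl⟩
      exact ⟨hx, h⟩
    rw [← Submodule.finrank_map_subtype_eq]
    exact Submodule.finrank_mono this
  omega

/-- For involutions `σ` and `ε` of a finite set, the second without fixed points, the orbit of a
fixed point of `σ` contains exactly one further fixed point of `σ`. -/
theorem exists_unique_other_fixed_point {X : Type*} [Finite X] {σ ε : X → X}
    (hσ : Function.Involutive σ) (hε : Function.Involutive ε) (hε' : ∀ x, ε x ≠ x) {x : X}
    (hx : σ x = x) :
    ∃ (O : Set X) (y : X), x ∈ O ∧ (∀ z ∈ O, σ z ∈ O) ∧ (∀ z ∈ O, ε z ∈ O) ∧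
      (∀ S : Set X, x ∈ S → (∀ z ∈ S, σ z ∈ S) → (∀ z ∈ S, ε z ∈ S) → O ⊆ S) ∧
      y ∈ O ∧ y ≠ x ∧ σ y = y ∧ ∀ z ∈ O, σ z = z → z = x ∨ z = y := by
  -- Since `σ` fixes `x`, the orbit of `x` under both involutions is the cycle of `x` under the
  -- product `τ`.
  set τ := σ ∘ ε with hτ
  have hinj : Function.Injective τ := hσ.injective.comp hε.injective
  have hper : x ∈ Function.periodicPts τ := hinj.mem_periodicPts x
  set r := Function.minimalPeriod τ x with hr
  have hrpos : 0 < r := Function.minimalPeriod_pos_of_mem_periodicPts hper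
  have hdiv : ∀ k, τ^[k] x = x ↔ r ∣ k := fun k => Function.isPeriodicPt_iff_minimalPeriod_dvd
  -- `σ` conjugates `τ` to its inverse and fixes `x`, so it acts on the cycle as `τ^k x ↦ τ^(-k) x`.
  -- Its fixed points are therefore given by `2k ≡ 0` modulo the length `r`.
  have hσk : ∀ k, τ^[k] (σ (τ^[k] x)) = x := by
    intro k
    induction k with
    | zero => simpa using hx
    | succ k ih =>
      rw [Function.iterate_succ_apply' τ k x, Function.iterate_succ_apply τ k]
      have : τ (σ (τ (τ^[k] x))) = σ (τ^[k] x) := by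
        simp only [hτ, Function.comp_apply]
        rw [hσ, hε]
      rw [this, ih]
  have hfix : ∀ k, σ (τ^[k] x) = τ^[k] x ↔ r ∣ 2 * k := by
    intro k
    rw [← hdiv, two_mul, Function.iterate_add_apply]
    constructor
    · intro h
      have := hσk k
      rwa [h] at this
    · intro h
      exact hinj.iterate k ((hσk k).trans h.symm)
  -- If `r = 2k + 1`, then `τ^(k+1) x = τ^(-k) x = σ (τ^k x)`, which makes `τ^k x` a fixed point of
  -- `ε`. With `r = 2m`, the other fixed point of `σ` is `τ^m x`.
  have hodd : Even r := by
    by_contra hodd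
    rw [Nat.not_even_iff_odd] at hodd
    obtain ⟨k, hk⟩ := hodd
    have h1 : τ^[k + 1 + k] x = x := (hdiv _).2 ⟨1, by omega⟩
    rw [Function.iterate_add_apply, Function.iterate_succ_apply] at h1
    have h2 : τ (τ^[k] x) = σ (τ^[k] x) := hinj.iterate k (h1.trans (hσk k).symm)
    exact hε' _ (hσ.injective h2)
  obtain ⟨m, hm⟩ := hodd
  have hσO : ∀ z ∈ Set.range fun k => τ^[k] x, σ z ∈ Set.range fun k => τ^[k] x := by
    rintro _ ⟨k, rfl⟩
    -- A natural number congruent to `-k` modulo `r`.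
    refine ⟨r * k - k, hinj.iterate k ?_⟩
    change τ^[k] (τ^[r * k - k] x) = _
    rw [hσk k, ← Function.iterate_add_apply, hdiv,
      Nat.add_sub_cancel' (Nat.le_mul_of_pos_left k hrpos)]
    exact ⟨k, rfl⟩
  refine ⟨Set.range fun k => τ^[k] x, τ^[m] x, ⟨0, rfl⟩, hσO, ?_, ?_, ⟨m, rfl⟩, ?_, ?_, ?_⟩
  · rintro _ ⟨k, rfl⟩
    have h := hσO (τ (τ^[k] x)) ⟨k + 1, Function.iterate_succ_apply' τ k x⟩
    simpa only [hτ, Function.comp_apply, hσ (ε _)] using h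
  · rintro S hxS hS hS' _ ⟨k, rfl⟩
    induction k with
    | zero => exact hxS
    | succ k ih =>
      change τ^[k + 1] x ∈ S
      rw [Function.iterate_succ_apply']
      exact hS _ (hS' _ ih)
  · rw [Ne, hdiv]
    intro h
    have := Nat.le_of_dvd (by omega) h
    omega
  · rw [hfix]
    exact ⟨1, by omega⟩
  · rintro z ⟨k, rfl⟩ hz
    change σ (τ^[k] x) = τ^[k] x at hz
    rw [hfix] at hz
    obtain ⟨l, hl⟩ := hz
    have hk : k = m * l := by
      have : 2 * k = 2 * (m * l) := by rw [hl, hm]; ring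
      omega
    change τ^[k] x = x ∨ τ^[k] x = τ^[m] x
    rcases Nat.even_or_odd l with ⟨j, hj⟩ | ⟨j, hj⟩
    · left
      rw [hdiv]
      exact ⟨j, by rw [hk, hj, hm]; ring⟩
    · right
      have : k = m + r * j := by rw [hk, hj, hm]; ring
      rw [this, Function.iterate_add_apply, (hdiv _).2 ⟨j, rfl⟩]

end

/-! ### Smoothings as involutions of the darts -/

noncomputable section

open Module

namespace TangleDiagram

variable (D : TangleDiagram)

theorem norm_eq_one_of_not_lt {D : TangleDiagram} {v : D.V} (h : ¬ ‖(v : ℂ)‖ < 1) :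
    ‖(v : ℂ)‖ = 1 :=
  le_antisymm (D.norm_le v) (not_lt.1 h)

theorem norm_lt_one_of_valence {D : TangleDiagram} {v : D.V}
    (h : (D.G.neighborSet v).ncard ≠ 1) : ‖(v : ℂ)‖ < 1 :=
  (D.norm_le v).lt_of_ne fun h' => h (D.boundary_valence v h')

theorem adj_nbr (x : D.Crossing) (i : Fin 4) : D.G.Adj x.1 (D.nbr x i) := by
  have : D.nbr x i ∈ D.G.neighborSet x.1 := by
    rw [← D.range_nbr]
    exact ⟨i, rfl⟩
  exact this

theorem nbr_injective (x : D.Crossing) : Function.Injective (D.nbr x) := by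
  have h1 : (Set.range (D.nbr x)).ncard = 4 := by rw [D.range_nbr]; exact x.2
  rw [← Set.image_univ] at h1
  have h2 := Set.injOn_of_ncard_image_eq (f := D.nbr x) (s := Set.univ)
    (by rw [h1, Set.ncard_univ, Nat.card_eq_fintype_card, Fintype.card_fin]) Set.finite_univ
  exact Set.injOn_univ.1 h2

variable {D}

theorem Passes.adj {s : D.State} {v a b : D.V} (h : D.Passes s v a b) :
    D.G.Adj v a ∧ D.G.Adj v b := by
  rcases h with ⟨-, h1, h2⟩ | ⟨x, rfl, h⟩
  · exact ⟨h1, h2⟩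
  · rcases h with ⟨-, ⟨rfl, rfl⟩ | ⟨rfl, rfl⟩⟩ | ⟨-, ⟨rfl, rfl⟩ | ⟨rfl, rfl⟩⟩ <;>
      exact ⟨D.adj_nbr _ _, D.adj_nbr _ _⟩

theorem Passes.norm_lt_one {s : D.State} {v a b : D.V} (h : D.Passes s v a b) :
    ‖(v : ℂ)‖ < 1 := by
  apply norm_lt_one_of_valence
  rcases h with ⟨h, -⟩ | ⟨x, rfl, -⟩
  · omega
  · have := x.2
    omega

/-- The smoothed curve passes at `v` between the distinct neighbours `a` and `b`. -/
def IsMate (s : D.State) (v a b : D.V) : Prop :=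
  a ≠ b ∧ (D.Passes s v a b ∨ D.Passes s v b a)

theorem IsMate.symm {s : D.State} {v a b : D.V} (h : IsMate s v a b) : IsMate s v b a :=
  ⟨h.1.symm, h.2.symm⟩

theorem IsMate.adj {s : D.State} {v a b : D.V} (h : IsMate s v a b) : D.G.Adj v b := by
  rcases h.2 with h | h
  · exact h.adj.2
  · exact h.adj.1

/-- The index of the neighbour of a crossing to which the `i`-th neighbour is joined. -/
def mateIndex : Bool → Fin 4 → Fin 4
  | true => ![3, 2, 1, 0]
  | false => ![1, 0, 3, 2]

theorem isMate_crossing_iff (s : D.State) (x : D.Crossing) (i j : Fin 4) :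
    IsMate s x.1 (D.nbr x i) (D.nbr x j) ↔ j = mateIndex (s x) i := by
  have h4 : (D.G.neighborSet x.1).ncard ≠ 2 := by rw [x.2]; norm_num
  have hinj : ∀ i j, D.nbr x i = D.nbr x j ↔ i = j := fun i j => (D.nbr_injective x).eq_iff
  have key : ∀ i j, D.Passes s x.1 (D.nbr x i) (D.nbr x j) ↔
      ((s x = true ∧ ((i = 1 ∧ j = 2) ∨ (i = 3 ∧ j = 0))) ∨
      (s x = false ∧ ((i = 0 ∧ j = 1) ∨ (i = 2 ∧ j = 3)))) := by
    intro i j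
    unfold Passes
    constructor
    · rintro (h | ⟨y, hy, h⟩)
      · exact absurd h.1 h4
      · obtain rfl : y = x := Subtype.ext hy
        simpa only [hinj] using h
    · intro h
      refine Or.inr ⟨x, rfl, ?_⟩
      simpa only [hinj] using h
  unfold IsMate
  rw [key, key, Ne, hinj]
  cases s x <;> revert i j <;> simp [mateIndex] <;> decide

theorem existsUnique_isMate (s : D.State) {v a : D.V} (hv : ‖(v : ℂ)‖ < 1) (ha : D.G.Adj v a) :
    ∃! b, IsMate s v a b := by
  rcases D.interior_valence v hv with h2 | h4
  · obtain ⟨x, y, hxy, hN⟩ := Set.ncard_eq_two.1 h2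
    have hmem : ∀ b, D.G.Adj v b ↔ b = x ∨ b = y := fun b => by
      have : b ∈ D.G.neighborSet v ↔ b ∈ ({x, y} : Set D.V) := by rw [hN]
      simpa using this
    have key : ∀ b, IsMate s v a b ↔ a ≠ b ∧ D.G.Adj v b := fun b =>
      ⟨fun h => ⟨h.1, h.adj⟩, fun h => ⟨h.1, Or.inl (Or.inl ⟨h2, ha, h.2⟩)⟩⟩
    simp only [key, hmem]
    rcases (hmem a).1 ha with rfl | rfl
    · exact ⟨y, ⟨hxy, Or.inr rfl⟩, fun b hb => hb.2.resolve_left hb.1.symm⟩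
    · exact ⟨x, ⟨hxy.symm, Or.inl rfl⟩, fun b hb => hb.2.resolve_right hb.1.symm⟩
  · obtain ⟨x, rfl⟩ : ∃ x : D.Crossing, x.1 = v := ⟨⟨v, h4⟩, rfl⟩
    have hr : ∀ b, D.G.Adj x.1 b → ∃ i, D.nbr x i = b := fun b hb => by
      have : b ∈ Set.range (D.nbr x) := by rw [D.range_nbr]; exact hb
      exact this
    obtain ⟨i, rfl⟩ := hr a ha
    refine ⟨D.nbr x (mateIndex (s x) i), (isMate_crossing_iff s x _ _).2 rfl, fun b hb => ?_⟩
    obtain ⟨j, rfl⟩ := hr b hb.adj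
    rw [(isMate_crossing_iff s x _ _).1 hb]

/-- The dart by which the smoothed curve leaves an interior vertex, if it enters through the
given one; boundary darts are fixed. -/
def mate (s : D.State) (d : D.G.Dart) : D.G.Dart :=
  open Classical in
  if h : ‖(d.fst : ℂ)‖ < 1 then
    ⟨(d.fst, (existsUnique_isMate s h d.adj).choose),
      (existsUnique_isMate s h d.adj).choose_spec.1.adj⟩
  else d

theorem mate_fst (s : D.State) (d : D.G.Dart) : (mate s d).fst = d.fst := by
  unfold mate
  split_ifs <;> rfl

theorem isMate_mate (s : D.State) {d : D.G.Dart} (h : ‖(d.fst : ℂ)‖ < 1) :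
    IsMate s d.fst d.snd (mate s d).snd := by
  unfold mate
  rw [dif_pos h]
  exact (existsUnique_isMate s h d.adj).choose_spec.1

theorem mate_of_boundary (s : D.State) {d : D.G.Dart} (h : ¬ ‖(d.fst : ℂ)‖ < 1) :
    mate s d = d := by
  unfold mate
  rw [dif_neg h]

theorem mate_eq_of_isMate (s : D.State) {v a b : D.V} (ha : D.G.Adj v a) (hb : D.G.Adj v b)
    (hv : ‖(v : ℂ)‖ < 1) (h : IsMate s v a b) : mate s ⟨(v, a), ha⟩ = ⟨(v, b), hb⟩ := by
  have h1 := isMate_mate s (d := ⟨(v, a), ha⟩) hv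
  have h2 := (existsUnique_isMate s hv ha).unique h h1
  apply SimpleGraph.Dart.ext
  exact Prod.ext (mate_fst _ _) h2.symm

theorem mate_ne (s : D.State) {d : D.G.Dart} (h : ‖(d.fst : ℂ)‖ < 1) : mate s d ≠ d := by
  intro h'
  have := (isMate_mate s h).1
  rw [h'] at this
  exact this rfl

theorem mate_eq_self_iff (s : D.State) (d : D.G.Dart) : mate s d = d ↔ ‖(d.fst : ℂ)‖ = 1 :=
  ⟨fun h => norm_eq_one_of_not_lt fun h' => mate_ne s h' h,
    fun h => mate_of_boundary s (by rw [h]; exact lt_irrefl _)⟩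

theorem mate_involutive (s : D.State) : Function.Involutive (mate s) := by
  intro d
  by_cases h : ‖(d.fst : ℂ)‖ < 1
  · have h1 := isMate_mate s h
    have h2 := mate_eq_of_isMate s h1.adj d.adj h h1.symm
    refine Eq.trans (congrArg (mate s) ?_) h2
    exact SimpleGraph.Dart.ext _ _ (Prod.ext (mate_fst _ _) rfl)
  · rw [mate_of_boundary s h, mate_of_boundary s h]

/-- The segment underlying a dart. -/
def seg (d : D.G.Dart) : D.G.edgeSet := ⟨d.edge, d.edge_mem⟩

theorem seg_symm (d : D.G.Dart) : seg d.symm = seg d := Subtype.ext d.edge_symm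

theorem seg_surjective : Function.Surjective (seg : D.G.Dart → D.G.edgeSet) := by
  rintro ⟨e, he⟩
  induction e with
  | _ a b => exact ⟨⟨(a, b), he⟩, rfl⟩

theorem seg_eq_iff {d d' : D.G.Dart} : seg d = seg d' ↔ d = d' ∨ d = d'.symm := by
  rw [seg, seg, Subtype.mk.injEq, SimpleGraph.dart_edge_eq_iff]

theorem smoothing_adj_mate (s : D.State) {d : D.G.Dart} (h : ‖(d.fst : ℂ)‖ < 1) :
    (D.smoothing s).Adj (seg d) (seg (mate s d)) := by
  have h1 := isMate_mate s h
  have h2 := mate_fst s d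
  rw [smoothing, SimpleGraph.fromRel_adj]
  refine ⟨?_, ?_⟩
  · rw [Ne, seg_eq_iff]
    rintro (h' | h')
    · exact mate_ne s h h'.symm
    · have h3 : d.fst = (mate s d).snd := congrArg (fun d => d.fst) h'
      have h4 : d.snd = (mate s d).fst := congrArg (fun d => d.snd) h'
      rw [h2] at h4
      exact d.fst_ne_snd h4.symm
  · have e1 : ((seg d : D.G.edgeSet) : Sym2 D.V) = s(d.fst, d.snd) := rfl
    have e2 : ((seg (mate s d) : D.G.edgeSet) : Sym2 D.V) = s(d.fst, (mate s d).snd) := by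
      rw [← h2]; rfl
    rcases h1.2 with h | h
    · exact Or.inl ⟨_, _, _, h, e1, e2⟩
    · exact Or.inr ⟨_, _, _, h, e2, e1⟩

theorem smoothing_reachable_mate (s : D.State) (d : D.G.Dart) :
    (D.smoothing s).Reachable (seg d) (seg (mate s d)) := by
  by_cases h : ‖(d.fst : ℂ)‖ < 1
  · exact (smoothing_adj_mate s h).reachable
  · rw [mate_of_boundary s h]

theorem exists_dart_of_smoothing_adj {s : D.State} {e f : D.G.edgeSet}
    (h : (D.smoothing s).Adj e f) : ∃ d, seg d = e ∧ seg (mate s d) = f := by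
  have key : ∀ e f : D.G.edgeSet, e ≠ f → (∃ v a b : D.V, D.Passes s v a b ∧
      (e : Sym2 D.V) = s(v, a) ∧ (f : Sym2 D.V) = s(v, b)) →
      ∃ d, seg d = e ∧ seg (mate s d) = f := by
    rintro e f hne ⟨v, a, b, hp, he, hf⟩
    have hab : a ≠ b := by
      rintro rfl
      exact hne (Subtype.ext (he.trans hf.symm))
    refine ⟨⟨(v, a), hp.adj.1⟩, Subtype.ext he.symm, ?_⟩
    rw [mate_eq_of_isMate s hp.adj.1 hp.adj.2 hp.norm_lt_one ⟨hab, Or.inl hp⟩]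
    exact Subtype.ext hf.symm
  rw [smoothing, SimpleGraph.fromRel_adj] at h
  obtain ⟨hne, h | h⟩ := h
  · exact key e f hne h
  · obtain ⟨d, h1, h2⟩ := key f e hne.symm h
    exact ⟨mate s d, h2, by rw [mate_involutive s d, h1]⟩

instance : Finite D.G.Dart := by
  classical
  exact Finite.of_fintype _

/-- An arc has two ends: the boundary darts are the fixed points of `mate s`, reversal has none, and
the common orbit of the two involutions consists of all darts on one component of the smoothing. -/
theorem exists_partner (s : D.State) {x : D.G.Dart} (hx : ‖(x.fst : ℂ)‖ = 1) :
    ∃ y : D.G.Dart, ‖(y.fst : ℂ)‖ = 1 ∧ y ≠ x ∧ (D.smoothing s).Reachable (seg x) (seg y) ∧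
      ∀ z : D.G.Dart, ‖(z.fst : ℂ)‖ = 1 → (D.smoothing s).Reachable (seg x) (seg z) →
        z = x ∨ z = y := by
  obtain ⟨O, y, hxO, hσ, hε, hmin, hyO, hyx, hy, hu⟩ := exists_unique_other_fixed_point
    (mate_involutive s) SimpleGraph.Dart.symm_involutive SimpleGraph.Dart.symm_ne
    ((mate_eq_self_iff s x).2 hx)
  refine ⟨y, (mate_eq_self_iff s y).1 hy, hyx, ?_, ?_⟩
  · refine hmin {d | (D.smoothing s).Reachable (seg x) (seg d)} (SimpleGraph.Reachable.refl _)
      ?_ ?_ hyO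
    · intro d hd
      exact SimpleGraph.Reachable.trans hd (smoothing_reachable_mate s d)
    · intro d hd
      change (D.smoothing s).Reachable (seg x) (seg d.symm)
      rw [seg_symm]
      exact hd
  · intro z hz hr
    refine hu z ?_ ((mate_eq_self_iff s z).2 hz)
    -- A walk of segments lifts to darts. The invariant carried along is that both darts of the
    -- current segment lie in `O`.
    have key : ∀ e f, (D.smoothing s).Walk e f → (∀ d, seg d = e → d ∈ O) →
        ∀ d, seg d = f → d ∈ O := by
      intro e f w
      induction w with
      | nil => exact id
      | cons hadj w ih =>
        intro he
        apply ih
        obtain ⟨d, rfl, rfl⟩ := exists_dart_of_smoothing_adj hadj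
        intro d' hd'
        rcases seg_eq_iff.1 hd' with rfl | rfl
        · exact hσ _ (he d rfl)
        · exact hε _ (hσ _ (he d rfl))
    obtain ⟨w⟩ := hr
    refine key _ _ w ?_ z rfl
    intro d hd
    rcases seg_eq_iff.1 hd with rfl | rfl
    · exact hxO
    · exact hε _ hxO

end TangleDiagram

end

/-! ### The loop inequality for two states with the same arcs -/

noncomputable section

open Module

namespace TangleDiagram

variable {D : TangleDiagram}

/-- The other boundary dart of the arc that starts at the given boundary dart. -/
def partner (s : D.State) (x : D.G.Dart) (hx : ‖(x.fst : ℂ)‖ = 1) : D.G.Dart :=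
  (exists_partner s hx).choose

theorem partner_boundary (s : D.State) {x : D.G.Dart} (hx : ‖(x.fst : ℂ)‖ = 1) :
    ‖((partner s x hx).fst : ℂ)‖ = 1 := (exists_partner s hx).choose_spec.1

theorem partner_ne (s : D.State) {x : D.G.Dart} (hx : ‖(x.fst : ℂ)‖ = 1) :
    partner s x hx ≠ x := (exists_partner s hx).choose_spec.2.1

theorem reachable_partner (s : D.State) {x : D.G.Dart} (hx : ‖(x.fst : ℂ)‖ = 1) :
    (D.smoothing s).Reachable (seg x) (seg (partner s x hx)) :=
  (exists_partner s hx).choose_spec.2.2.1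

theorem eq_or_eq_partner (s : D.State) {x z : D.G.Dart} (hx : ‖(x.fst : ℂ)‖ = 1)
    (hz : ‖(z.fst : ℂ)‖ = 1) (h : (D.smoothing s).Reachable (seg x) (seg z)) :
    z = x ∨ z = partner s x hx := (exists_partner s hx).choose_spec.2.2.2 z hz h

/-- The involution of darts that follows the smoothing by `s` at interior vertices and the arcs of
the smoothing by `t` outside the disk. -/
def closedMate (s t : D.State) (d : D.G.Dart) : D.G.Dart :=
  open Classical in
  if h : ‖(d.fst : ℂ)‖ < 1 then mate s d else partner t d (norm_eq_one_of_not_lt h)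

theorem closedMate_interior (s t : D.State) {d : D.G.Dart} (h : ‖(d.fst : ℂ)‖ < 1) :
    closedMate s t d = mate s d := by rw [closedMate, dif_pos h]

theorem closedMate_boundary (s t : D.State) {d : D.G.Dart} (h : ‖(d.fst : ℂ)‖ = 1) :
    closedMate s t d = partner t d h := by
  rw [closedMate, dif_neg (by rw [h]; exact lt_irrefl _)]

theorem closedMate_ne (s t : D.State) (d : D.G.Dart) : closedMate s t d ≠ d := by
  by_cases h : ‖(d.fst : ℂ)‖ < 1
  · rw [closedMate_interior s t h]
    exact mate_ne s h
  · rw [closedMate_boundary s t (norm_eq_one_of_not_lt h)]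
    exact partner_ne t _

theorem closedMate_involutive (s t : D.State) : Function.Involutive (closedMate s t) := by
  intro d
  by_cases h : ‖(d.fst : ℂ)‖ < 1
  · rw [closedMate_interior s t h, closedMate_interior s t (by rw [mate_fst]; exact h),
      mate_involutive]
  · have h1 := norm_eq_one_of_not_lt h
    have h2 := partner_boundary t h1
    rw [closedMate_boundary s t h1, closedMate_boundary s t h2]
    refine ((eq_or_eq_partner t h2 h1 (reachable_partner t h1).symm).resolve_left ?_).symm
    exact (partner_ne t h1).symm

instance (s : D.State) : Finite (D.smoothing s).ConnectedComponent := Quot.finite _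

/-- Functions on the components of the smoothing pull back injectively to functions on darts. The
hypothesis says that the outer arcs taken from `t` join only ends in the same component, so the
pullbacks are invariant. -/
theorem card_components_le_finrank [Fintype D.G.Dart] (s t : D.State)
    (h : ∀ (x : D.G.Dart) (hx : ‖(x.fst : ℂ)‖ = 1),
      (D.smoothing s).Reachable (seg x) (seg (partner t x hx))) :
    Nat.card (D.smoothing s).ConnectedComponent ≤ finrank (ZMod 2)
      ↥(invariantFunctions (closedMate s t) ⊓
        invariantFunctions (SimpleGraph.Dart.symm : D.G.Dart → D.G.Dart)) := by
  classical
  have := Fintype.ofFinite (D.smoothing s).ConnectedComponent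
  let c : D.G.Dart → (D.smoothing s).ConnectedComponent :=
    fun d => (D.smoothing s).connectedComponentMk (seg d)
  have hc : Function.Surjective c := by
    intro K
    induction K using SimpleGraph.ConnectedComponent.ind with
    | h e =>
      obtain ⟨d, rfl⟩ := seg_surjective e
      exact ⟨d, rfl⟩
  let φ := LinearMap.funLeft (ZMod 2) (ZMod 2) c
  have hφ : Function.Injective φ := LinearMap.funLeft_injective_of_surjective _ _ _ hc
  have hr : LinearMap.range φ ≤ invariantFunctions (closedMate s t) ⊓
        invariantFunctions (SimpleGraph.Dart.symm : D.G.Dart → D.G.Dart) := by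
    rintro _ ⟨f, rfl⟩
    constructor
    · intro d
      refine congrArg f (SimpleGraph.ConnectedComponent.eq.2 ?_)
      by_cases hd : ‖(d.fst : ℂ)‖ < 1
      · rw [closedMate_interior s t hd]
        exact (smoothing_reachable_mate s d).symm
      · rw [closedMate_boundary s t (norm_eq_one_of_not_lt hd)]
        exact (h d _).symm
    · intro d
      exact congrArg f (congrArg (D.smoothing s).connectedComponentMk (seg_symm d))
  have h1 := Submodule.finrank_mono hr
  rwa [LinearMap.finrank_range_of_inj hφ, finrank_fintype_fun_eq_card,
    ← Nat.card_eq_fintype_card] at h1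

/-- The dart from a crossing to its `i`-th neighbour. -/
def crossingDart (x : D.Crossing) (i : Fin 4) : D.G.Dart := ⟨(x.1, D.nbr x i), D.adj_nbr x i⟩

theorem crossing_norm_lt_one (x : D.Crossing) : ‖(x.1 : ℂ)‖ < 1 :=
  norm_lt_one_of_valence (by rw [x.2]; norm_num)

theorem mate_crossingDart (s : D.State) (x : D.Crossing) (i : Fin 4) :
    mate s (crossingDart x i) = crossingDart x (mateIndex (s x) i) :=
  mate_eq_of_isMate s _ _ (crossing_norm_lt_one x) ((isMate_crossing_iff s x _ _).2 rfl)

theorem exists_crossingDart {d : D.G.Dart} (x : D.Crossing) (hx : x.1 = d.fst) :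
    ∃ i, d = crossingDart x i := by
  have h : d.snd ∈ Set.range (D.nbr x) := by
    rw [D.range_nbr, hx]
    exact d.adj
  obtain ⟨i, hi⟩ := h
  exact ⟨i, SimpleGraph.Dart.ext _ _ (Prod.ext hx.symm hi.symm)⟩

/-- Two different smoothings together link all four neighbours. Two equal ones leave two pairs,
separating `0` from `2`, and `h0` bridges them. -/
theorem eq_of_mateIndex {α : Type*} {g : Fin 4 → α} {b b' : Bool}
    (h : ∀ i, g (mateIndex b i) = g i) (h' : ∀ i, g (mateIndex b' i) = g i)
    (h0 : b = b' → g 0 = g 2) (i : Fin 4) : g i = g 0 := by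
  have k0 := h 0
  have k1 := h 1
  have k2 := h 2
  have l0 := h' 0
  have l1 := h' 1
  have l2 := h' 2
  revert h0 k0 k1 k2 l0 l1 l2
  clear h h'
  cases b <;> cases b' <;> fin_cases i <;> simp [mateIndex] <;> grind

/-- Each pair of the smoothing `b'` takes one element from each pair of `b`, so a single equation
makes all four values equal. -/
theorem apply_mateIndex_of_ne {α : Type*} {g : Fin 4 → α} {b b' : Bool}
    (h : ∀ i, g (mateIndex b i) = g i) (hb : b ≠ b') (h0 : g 0 = g (mateIndex b' 0)) (i : Fin 4) :
    g (mateIndex b' i) = g i := by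
  have k0 := h 0
  have k1 := h 1
  have k2 := h 2
  revert hb h0 k0 k1 k2
  clear h
  cases b <;> cases b' <;> fin_cases i <;> simp [mateIndex] <;> grind

theorem apply_mateIndex {s t : D.State} {f : D.G.Dart → ZMod 2}
    (hf : f ∈ invariantFunctions (closedMate s t)) (x : D.Crossing) (i : Fin 4) :
    f (crossingDart x (mateIndex (s x) i)) = f (crossingDart x i) := by
  have h := hf (crossingDart x i)
  rwa [closedMate_interior s t (crossing_norm_lt_one x), mate_crossingDart] at h

/-- The invariants of `closedMate s s` have at least half the full dimension. The two involutions
agree except at crossings where the states differ, and there one linear equation each suffices by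
`apply_mateIndex_of_ne`. -/
theorem card_dart_le_finrank_inf [Fintype D.G.Dart] (s s' : D.State) :
    Fintype.card D.G.Dart ≤ 2 * (finrank (ZMod 2) ↥(invariantFunctions (closedMate s s) ⊓
      invariantFunctions (closedMate s' s)) + Nat.card {x : D.Crossing // s x ≠ s' x}) := by
  classical
  have h1 := card_le_two_mul_finrank_invariantFunctions (closedMate_involutive s s)
  let φ : (D.G.Dart → ZMod 2) →ₗ[ZMod 2] ({x : D.Crossing // s x ≠ s' x} → ZMod 2) :=
    LinearMap.funLeft _ _ (fun x => crossingDart x.1 0) -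
      LinearMap.funLeft _ _ (fun x => crossingDart x.1 (mateIndex (s' x.1) 0))
  have h2 := finrank_le_finrank_inf_ker_add (invariantFunctions (closedMate s s)) φ
  have h3 : invariantFunctions (closedMate s s) ⊓ LinearMap.ker φ ≤
      invariantFunctions (closedMate s s) ⊓ invariantFunctions (closedMate s' s) := by
    rintro f ⟨hf, hφ⟩
    refine ⟨hf, fun d => ?_⟩
    by_cases hd : ‖(d.fst : ℂ)‖ < 1
    · rw [closedMate_interior s' s hd]
      by_cases hx : (D.G.neighborSet d.fst).ncard = 4
      · obtain ⟨i, hi⟩ := exists_crossingDart (d := d) ⟨d.fst, hx⟩ rfl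
        generalize (⟨d.fst, hx⟩ : D.Crossing) = x at hi
        subst hi
        rw [mate_crossingDart]
        have key := apply_mateIndex hf x
        by_cases hs : s x = s' x
        · rw [← hs]
          exact key i
        · have h4 : f (crossingDart x 0) = f (crossingDart x (mateIndex (s' x) 0)) :=
            sub_eq_zero.1 (congrFun (LinearMap.mem_ker.1 hφ) ⟨x, hs⟩)
          have h5 := apply_mateIndex_of_ne (g := fun i => f (crossingDart x i)) key hs h4
          exact h5 i
      · have h2 := (D.interior_valence _ hd).resolve_right hx
        have h3 := isMate_mate s hd
        have h4 : IsMate s' d.fst d.snd (mate s d).snd :=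
          ⟨h3.1, Or.inl (Or.inl ⟨h2, d.adj, h3.adj⟩)⟩
        have h5 : mate s' d = mate s d := by
          have := mate_eq_of_isMate s' d.adj h3.adj hd h4
          refine this.trans (SimpleGraph.Dart.ext _ _ (Prod.ext (mate_fst s d).symm rfl))
        rw [h5, ← closedMate_interior s s hd]
        exact hf d
    · have hd := norm_eq_one_of_not_lt hd
      rw [closedMate_boundary s' s hd, ← closedMate_boundary s s hd]
      exact hf d
  have h4 := Submodule.finrank_mono h3
  rw [← Nat.card_eq_fintype_card (α := {x : D.Crossing // s x ≠ s' x})] at h2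
  omega

theorem exists_adj (v : D.V) : ∃ w, D.G.Adj v w := by
  have : (D.G.neighborSet v).ncard ≠ 0 := by
    by_cases h : ‖(v : ℂ)‖ < 1
    · rcases D.interior_valence v h with h | h <;> omega
    · rw [D.boundary_valence v (norm_eq_one_of_not_lt h)]
      norm_num
  exact Set.nonempty_of_ncard_ne_zero this

instance : Finite D.G.ConnectedComponent := Quot.finite _

/-- One equation at each crossing smoothed alike makes an invariant function constant on the darts
leaving any vertex (`eq_of_mateIndex`). Invariance under reversal carries the value along edges, so
the function comes from the components of the diagram. -/
theorem finrank_inf_inf_le [Fintype D.G.Dart] (s s' : D.State) :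
    finrank (ZMod 2) ↥(invariantFunctions (closedMate s s) ⊓
      invariantFunctions (closedMate s' s) ⊓
      invariantFunctions (SimpleGraph.Dart.symm : D.G.Dart → D.G.Dart)) ≤
    Nat.card D.G.ConnectedComponent + Nat.card {x : D.Crossing // s x = s' x} := by
  classical
  have := Fintype.ofFinite D.G.ConnectedComponent
  set W := invariantFunctions (closedMate s s) ⊓
      invariantFunctions (closedMate s' s) ⊓
      invariantFunctions (SimpleGraph.Dart.symm : D.G.Dart → D.G.Dart) with hW
  let φ : (D.G.Dart → ZMod 2) →ₗ[ZMod 2] ({x : D.Crossing // s x = s' x} → ZMod 2) :=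
    LinearMap.funLeft _ _ (fun x => crossingDart x.1 0) -
      LinearMap.funLeft _ _ (fun x => crossingDart x.1 2)
  have h2 := finrank_le_finrank_inf_ker_add W φ
  let c : D.G.Dart → D.G.ConnectedComponent := fun d => D.G.connectedComponentMk d.fst
  have h3 : W ⊓ LinearMap.ker φ ≤
      LinearMap.range (LinearMap.funLeft (ZMod 2) (ZMod 2) c) := by
    rintro f ⟨⟨⟨hf, hf'⟩, hε⟩, hφ⟩
    have hstar : ∀ d d' : D.G.Dart, d.fst = d'.fst → f d = f d' := by
      intro d d' hdd
      by_cases hd : ‖(d.fst : ℂ)‖ < 1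
      · by_cases hx : (D.G.neighborSet d.fst).ncard = 4
        · obtain ⟨i, hi⟩ := exists_crossingDart (d := d) ⟨d.fst, hx⟩ rfl
          obtain ⟨j, hj⟩ := exists_crossingDart (d := d') ⟨d.fst, hx⟩ hdd
          rw [hi, hj]
          set x : D.Crossing := ⟨d.fst, hx⟩
          have key := apply_mateIndex hf x
          have key' := apply_mateIndex hf' x
          have h0 := eq_of_mateIndex (g := fun i => f (crossingDart x i)) key key' fun hs =>
            sub_eq_zero.1 (congrFun (LinearMap.mem_ker.1 hφ) ⟨x, hs⟩)
          exact (h0 i).trans (h0 j).symm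
        · have h2 := (D.interior_valence _ hd).resolve_right hx
          by_cases hs : d.snd = d'.snd
          · rw [SimpleGraph.Dart.ext d d' (Prod.ext hdd hs)]
          · have ha : D.G.Adj d.fst d'.snd := by rw [hdd]; exact d'.adj
            have h5 := mate_eq_of_isMate s d.adj ha hd
              ⟨hs, Or.inl (Or.inl ⟨h2, d.adj, ha⟩)⟩
            have h6 : mate s d = d' := h5.trans (SimpleGraph.Dart.ext _ _ (Prod.ext hdd rfl))
            rw [← h6, ← closedMate_interior s s hd]
            exact (hf d).symm
      · obtain ⟨w, hw⟩ := Set.ncard_eq_one.1 (D.boundary_valence _ (norm_eq_one_of_not_lt hd))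
        have e1 : d.snd ∈ D.G.neighborSet d.fst := d.adj
        have e2 : d'.snd ∈ D.G.neighborSet d.fst := by rw [hdd]; exact d'.adj
        rw [hw, Set.mem_singleton_iff] at e1 e2
        rw [SimpleGraph.Dart.ext d d' (Prod.ext hdd (e1.trans e2.symm))]
    let F : D.V → ZMod 2 := fun v => f ⟨(v, (exists_adj v).choose), (exists_adj v).choose_spec⟩
    have hF : ∀ d : D.G.Dart, f d = F d.fst := fun d => hstar _ _ rfl
    have hadj : ∀ v w, D.G.Adj v w → F v = F w := by
      intro v w hvw
      have h1 := hF ⟨(v, w), hvw⟩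
      have h2 := hF (SimpleGraph.Dart.symm ⟨(v, w), hvw⟩)
      rw [hε] at h2
      exact h1.symm.trans h2
    have hwalk : ∀ v w, (p : D.G.Walk v w) → p.IsPath → F v = F w := by
      intro v w p _
      induction p with
      | nil => rfl
      | cons h p ih => exact (hadj _ _ h).trans (ih (by simp_all))
    refine ⟨SimpleGraph.ConnectedComponent.lift F hwalk, ?_⟩
    ext d
    exact (hF d).symm
  have h4 := (Submodule.finrank_mono h3).trans (LinearMap.finrank_range_le _)
  rw [finrank_fintype_fun_eq_card, ← Nat.card_eq_fintype_card] at h4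
  rw [← Nat.card_eq_fintype_card (α := {x : D.Crossing // s x = s' x})] at h2
  omega

theorem numBoundary_le_card : D.numBoundary ≤ Nat.card {d : D.G.Dart // ‖(d.fst : ℂ)‖ = 1} := by
  rw [numBoundary, ← Nat.card_coe_set_eq]
  let F : D.boundary → {d : D.G.Dart // ‖(d.fst : ℂ)‖ = 1} := fun z =>
    ⟨⟨(⟨z.1, z.2.1⟩, (exists_adj ⟨z.1, z.2.1⟩).choose), (exists_adj ⟨z.1, z.2.1⟩).choose_spec⟩,
      z.2.2⟩
  refine Nat.card_le_card_of_injective F fun z z' h => ?_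
  exact Subtype.ext (congrArg (fun d => (d.1.fst : ℂ)) h)

/-- A component that is not a loop contains at most two boundary darts, by `eq_or_eq_partner`. -/
theorem two_mul_numLoops_add_le (s : D.State) : 2 * D.numLoops s + D.numBoundary ≤
    2 * Nat.card (D.smoothing s).ConnectedComponent := by
  classical
  have := Fintype.ofFinite D.G.Dart
  have := Fintype.ofFinite (D.smoothing s).ConnectedComponent
  let P : (D.smoothing s).ConnectedComponent → Prop := fun K =>
    ∀ e : D.G.edgeSet, (D.smoothing s).connectedComponentMk e = K →
      ∀ v : D.V, v ∈ (e : Sym2 D.V) → ‖(v : ℂ)‖ < 1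
  let c : D.G.Dart → (D.smoothing s).ConnectedComponent :=
    fun d => (D.smoothing s).connectedComponentMk (seg d)
  have h1 : D.numLoops s = Nat.card {K // P K} := rfl
  have h2 : Fintype.card {K // P K} + Fintype.card {K // ¬ P K} =
      Fintype.card (D.smoothing s).ConnectedComponent := by
    rw [Fintype.card_subtype_compl]
    exact Nat.add_sub_cancel' (Fintype.card_subtype_le P)
  have h3 : Finset.card (Finset.univ.filter fun d : D.G.Dart => ‖(d.fst : ℂ)‖ = 1) ≤
      2 * Finset.card (Finset.univ.filter fun K => ¬ P K) := by
    refine Finset.card_le_mul_card_image_of_maps_to (f := c) ?_ 2 ?_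
    · intro d hd
      rw [Finset.mem_filter_univ] at hd ⊢
      intro h
      have := h (seg d) rfl d.fst (Sym2.mem_mk_left _ _)
      linarith
    · intro K hK
      by_cases hne : ∃ d, ‖((d : D.G.Dart).fst : ℂ)‖ = 1 ∧ c d = K
      · obtain ⟨d, hd, rfl⟩ := hne
        refine (Finset.card_le_card (t := {d, partner s d hd}) ?_).trans Finset.card_le_two
        intro z hz
        simp only [Finset.mem_filter, Finset.mem_univ, true_and] at hz
        rw [Finset.mem_insert, Finset.mem_singleton]
        exact eq_or_eq_partner s hd hz.1 (SimpleGraph.ConnectedComponent.eq.1 hz.2.symm)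
      · push Not at hne
        rw [Finset.filter_eq_empty_iff.2]
        · simp
        · intro d hd
          exact hne d (by simpa using hd)
  have h4 := numBoundary_le_card (D := D)
  rw [Nat.card_eq_fintype_card, Fintype.card_subtype] at h4
  rw [Fintype.card_subtype (fun K => ¬ P K)] at h2
  rw [h1, Nat.card_eq_fintype_card, Nat.card_eq_fintype_card]
  omega

/-- Boundary vertices are univalent, so the segment ending at a boundary point is unique. -/
theorem connects_iff (s : D.State) {x y : D.G.Dart} (hx : ‖(x.fst : ℂ)‖ = 1)
    (hy : ‖(y.fst : ℂ)‖ = 1) :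
    D.Connects s x.fst y.fst ↔ (D.smoothing s).Reachable (seg x) (seg y) := by
  have key : ∀ (z : D.G.Dart), ‖(z.fst : ℂ)‖ = 1 → ∀ e : D.G.edgeSet,
      (∃ v : D.V, v ∈ (e : Sym2 D.V) ∧ (v : ℂ) = z.fst) → e = seg z := by
    rintro z hz e ⟨v, hv, hvz⟩
    obtain rfl : v = z.fst := Subtype.ext hvz
    obtain ⟨w, hw⟩ := Sym2.mem_iff_exists.1 hv
    have hadj : D.G.Adj z.fst w := by
      rw [← SimpleGraph.mem_edgeSet, ← hw]
      exact e.2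
    obtain ⟨u, hu⟩ := Set.ncard_eq_one.1 (D.boundary_valence _ hz)
    have e1 : z.snd ∈ D.G.neighborSet z.fst := z.adj
    have e2 : w ∈ D.G.neighborSet z.fst := hadj
    rw [hu, Set.mem_singleton_iff] at e1 e2
    refine Subtype.ext (hw.trans ?_)
    rw [e2, ← e1]
    rfl
  constructor
  · rintro ⟨e, f, he, hf, h⟩
    rwa [key x hx e he, key y hy f hf] at h
  · intro h
    exact ⟨seg x, seg y, ⟨x.fst, Sym2.mem_mk_left _ _, rfl⟩, ⟨y.fst, Sym2.mem_mk_left _ _, rfl⟩, h⟩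

/-- Two states with the same arcs have few loops and differing crossings altogether. -/
theorem numLoops_add_numLoops_le (s s' : D.State)
    (h : ∀ p ∈ D.boundary, ∀ q ∈ D.boundary, D.Connects s p q ↔ D.Connects s' p q) :
    Nat.card {x : D.Crossing // s x ≠ s' x} + D.numLoops s + D.numLoops s' + D.numBoundary ≤
      2 * (D.numCrossings + D.numComponents) := by
  classical
  have := Fintype.ofFinite D.G.Dart
  have h1 := finrank_invariantFunctions_three (closedMate_involutive s s)
    (closedMate_involutive s' s) (SimpleGraph.Dart.symm_involutive (G := D.G))
    (closedMate_ne s s) (closedMate_ne s' s) SimpleGraph.Dart.symm_ne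
  have h2 := card_components_le_finrank s s fun x hx => reachable_partner s hx
  -- The smoothing by `s'` is closed up with the arcs of `s`; this respects its components because
  -- both states connect the same boundary points.
  have h3 := card_components_le_finrank s' s fun x hx =>
    (connects_iff s' hx (partner_boundary s hx)).1 <|
      (h _ ⟨x.fst.2, hx⟩ _ ⟨(partner s x hx).fst.2, partner_boundary s hx⟩).1 <|
        (connects_iff s hx (partner_boundary s hx)).2 (reachable_partner s hx)
  have h4 := card_dart_le_finrank_inf s s'
  have h5 := finrank_inf_inf_le s s'
  have h6 := two_mul_numLoops_add_le s
  have h7 := two_mul_numLoops_add_le s'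
  have h8 : Nat.card {x : D.Crossing // s x = s' x} + Nat.card {x : D.Crossing // s x ≠ s' x} =
      D.numCrossings := by
    rw [numCrossings, Nat.card_eq_fintype_card, Nat.card_eq_fintype_card, Nat.card_eq_fintype_card]
    rw [Fintype.card_subtype_compl]
    exact Nat.add_sub_cancel' (Fintype.card_subtype_le _)
  -- Write `ab`, `ac`, `bc`, `abc` for the four dimensions in `h1`, and `d` for the number of
  -- differing crossings. Substituting `|X| ≤ 2(ab + d)` and `abc ≤ c + n - d` into `h1` leaves `ac
  -- + bc ≤ 2(n + c) - d`, while `h2`, `h3`, `h6`, `h7` give `l + l' + g ≤ ac + bc`.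
  rw [numComponents]
  omega

end TangleDiagram

end

/-! ### The dimension of the cycle space of a graph -/

noncomputable section

open Module

namespace SimpleGraph

variable {V : Type*} (G : SimpleGraph V)

/-- The first end of an edge, in an arbitrary orientation. -/
def src (e : G.edgeSet) : V := (Quot.out (e : Sym2 V)).1

/-- The second end of an edge, in an arbitrary orientation. -/
def tgt (e : G.edgeSet) : V := (Quot.out (e : Sym2 V)).2

theorem mk_src_tgt (e : G.edgeSet) : s(G.src e, G.tgt e) = (e : Sym2 V) :=
  Quot.out_eq (e : Sym2 V)

theorem adj_src_tgt (e : G.edgeSet) : G.Adj (G.src e) (G.tgt e) := by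
  rw [← SimpleGraph.mem_edgeSet, mk_src_tgt]
  exact e.2

open Classical in
/-- The oriented incidence matrix. -/
def orientedInc (K : Type*) [Field K] : Matrix G.edgeSet V K :=
  Matrix.of fun e v => (if v = G.tgt e then 1 else 0) - (if v = G.src e then 1 else 0)

variable {K : Type*} [Field K]

theorem orientedInc_mulVec [Fintype V] (f : V → K) (e : G.edgeSet) :
    (G.orientedInc K).mulVec f e = f (G.tgt e) - f (G.src e) := by
  classical
  simp [Matrix.mulVec, dotProduct, orientedInc, sub_mul, Finset.sum_sub_distrib]

/-- The edge vectors with vanishing boundary. -/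
def cycleSpace (K : Type*) [Field K] [Fintype G.edgeSet] : Submodule K (G.edgeSet → K) :=
  LinearMap.ker (G.orientedInc K).transpose.mulVecLin

theorem mem_cycleSpace [Fintype G.edgeSet] {z : G.edgeSet → K} :
    z ∈ G.cycleSpace K ↔ ∀ v, ∑ e, G.orientedInc K e v * z e = 0 := by
  rw [cycleSpace, LinearMap.mem_ker]
  constructor
  · intro h v
    exact congrFun h v
  · intro h
    ext v
    exact h v

/-- A function is killed by the coboundary exactly when it agrees at the ends of every edge, so when
it descends to components. -/
theorem finrank_ker_orientedInc [Fintype V] :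
    finrank K (LinearMap.ker (G.orientedInc K).mulVecLin) = Nat.card G.ConnectedComponent := by
  classical
  have : Finite G.ConnectedComponent := Quot.finite _
  have := Fintype.ofFinite G.ConnectedComponent
  let φ : (G.ConnectedComponent → K) →ₗ[K] (V → K) := LinearMap.funLeft K K G.connectedComponentMk
  have hφ : Function.Injective φ := LinearMap.funLeft_injective_of_surjective _ _ _ Quot.mk_surjective
  have hr : LinearMap.range φ = LinearMap.ker (G.orientedInc K).mulVecLin := by
    ext f
    rw [LinearMap.mem_ker, LinearMap.mem_range]
    constructor
    · rintro ⟨F, rfl⟩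
      ext e
      rw [Matrix.mulVecLin_apply, orientedInc_mulVec, Pi.zero_apply, sub_eq_zero]
      exact congrArg F (SimpleGraph.ConnectedComponent.eq.2 (G.adj_src_tgt e).reachable.symm)
    · intro h
      have hadj : ∀ v w, G.Adj v w → f v = f w := by
        intro v w hvw
        have h1 := congrFun h ⟨s(v, w), hvw⟩
        rw [Matrix.mulVecLin_apply, orientedInc_mulVec, Pi.zero_apply, sub_eq_zero] at h1
        have h2 := G.mk_src_tgt ⟨s(v, w), hvw⟩
        rcases Sym2.eq_iff.1 h2 with ⟨h3, h4⟩ | ⟨h3, h4⟩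
        · rw [h3, h4] at h1
          exact h1.symm
        · rw [h3, h4] at h1
          exact h1
      have hwalk : ∀ v w, (p : G.Walk v w) → p.IsPath → f v = f w := by
        intro v w p _
        induction p with
        | nil => rfl
        | cons h p ih => exact (hadj _ _ h).trans (ih (by simp_all))
      exact ⟨SimpleGraph.ConnectedComponent.lift f hwalk, rfl⟩
  rw [← hr, LinearMap.finrank_range_of_inj hφ, finrank_fintype_fun_eq_card, Nat.card_eq_fintype_card]

theorem finrank_cycleSpace [Fintype V] [Fintype G.edgeSet] :
    finrank K (G.cycleSpace K) + Fintype.card V =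
      Fintype.card G.edgeSet + Nat.card G.ConnectedComponent := by
  have h1 := LinearMap.finrank_range_add_finrank_ker (G.orientedInc K).mulVecLin
  have h2 := LinearMap.finrank_range_add_finrank_ker (G.orientedInc K).transpose.mulVecLin
  have h3 := Matrix.rank_transpose (G.orientedInc K)
  rw [Matrix.rank, Matrix.rank] at h3
  rw [finrank_ker_orientedInc, finrank_fintype_fun_eq_card] at h1
  rw [finrank_fintype_fun_eq_card] at h2
  rw [cycleSpace]
  omega

end SimpleGraph

end

/-! ### Segments in the plane and local constancy off the diagram -/

noncomputable section

open Module Topology Filter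

/-- A function on a set whose closure contains the preconnected set `C`, locally constant around
each point of `C`, takes a single value around `C`. -/
theorem IsPreconnected.exists_eventually_eq {X Y : Type*} [TopologicalSpace X] [Nonempty Y]
    {C T : Set X} (hC : IsPreconnected C) (hCT : C ⊆ closure T) {f : X → Y}
    (h : ∀ x ∈ C, ∃ c, ∀ᶠ p in 𝓝[T] x, f p = c) :
    ∃ c, ∀ x ∈ C, ∀ᶠ p in 𝓝[T] x, f p = c := by
  rcases C.eq_empty_or_nonempty with rfl | ⟨x₀, hx₀⟩
  · exact ⟨Classical.arbitrary Y, by simp⟩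
  choose! g hg using h
  -- For `y` near `x`, a point of `T` close enough to `y` sees both limiting values.
  have hloc : ∀ x ∈ C, ∀ᶠ y in 𝓝[C] x, g y = g x := by
    intro x hx
    have h1 := hg x hx
    rw [eventually_nhdsWithin_iff] at h1
    have h2 := h1.eventually_nhds
    filter_upwards [mem_nhdsWithin_of_mem_nhds h2, self_mem_nhdsWithin] with y hy hyC
    have h3 : ∀ᶠ p in 𝓝[T] y, f p = g x := eventually_nhdsWithin_iff.2 hy
    have : (𝓝[T] y).NeBot := mem_closure_iff_nhdsWithin_neBot.1 (hCT hyC)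
    obtain ⟨p, hp1, hp2⟩ := (h3.and (hg y hyC)).exists
    exact hp2.symm.trans hp1
  let _ : TopologicalSpace Y := ⊥
  have : DiscreteTopology Y := ⟨rfl⟩
  have hcont : ContinuousOn g C := by
    intro x hx
    rw [ContinuousWithinAt, nhds_discrete, tendsto_pure]
    exact hloc x hx
  refine ⟨g x₀, fun x hx => ?_⟩
  rw [hC.constant hcont hx₀ hx]
  exact hg x hx

/-- The affine coordinate that maps `a` to `0` and `b` to `1`. -/
def segCoord (a b p : ℂ) : ℂ := (p - a) / (b - a)

theorem continuous_segCoord (a b : ℂ) : Continuous (segCoord a b) := by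
  unfold segCoord
  fun_prop

theorem segCoord_swap {a b : ℂ} (h : a ≠ b) (p : ℂ) : segCoord b a p = 1 - segCoord a b p := by
  unfold segCoord
  have h1 : a - b ≠ 0 := sub_ne_zero.2 h
  have h2 : b - a ≠ 0 := sub_ne_zero.2 h.symm
  field_simp
  ring

theorem segCoord_spec {a b : ℂ} (h : a ≠ b) (p : ℂ) : p = a + segCoord a b p * (b - a) := by
  unfold segCoord
  have h2 : b - a ≠ 0 := sub_ne_zero.2 h.symm
  field_simp
  ring

theorem mem_segment_iff_segCoord {a b p : ℂ} (h : a ≠ b) :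
    p ∈ segment ℝ a b ↔ (segCoord a b p).im = 0 ∧ (segCoord a b p).re ∈ Set.Icc (0 : ℝ) 1 := by
  have h2 : b - a ≠ 0 := sub_ne_zero.2 h.symm
  rw [segment_eq_image']
  constructor
  · rintro ⟨t, ht, rfl⟩
    have : segCoord a b (a + t • (b - a)) = t := by
      simp [segCoord, h2]
    simp only [this, Complex.ofReal_im, Complex.ofReal_re, true_and]
    exact ht
  · rintro ⟨h3, h4⟩
    refine ⟨_, h4, ?_⟩
    have : segCoord a b p = ((segCoord a b p).re : ℂ) := Complex.ext rfl h3
    simp only [Complex.real_smul]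
    rw [← this, ← segCoord_spec h]

theorem mem_openSegment_iff_segCoord {a b p : ℂ} (h : a ≠ b) :
    p ∈ openSegment ℝ a b ↔
      (segCoord a b p).im = 0 ∧ (segCoord a b p).re ∈ Set.Ioo (0 : ℝ) 1 := by
  have h2 : b - a ≠ 0 := sub_ne_zero.2 h.symm
  rw [openSegment_eq_image']
  constructor
  · rintro ⟨t, ht, rfl⟩
    have : segCoord a b (a + t • (b - a)) = t := by
      simp [segCoord, h2]
    simp only [this, Complex.ofReal_im, Complex.ofReal_re, true_and]
    exact ht
  · rintro ⟨h3, h4⟩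
    refine ⟨_, h4, ?_⟩
    have : segCoord a b p = ((segCoord a b p).re : ℂ) := Complex.ext rfl h3
    simp only [Complex.real_smul]
    rw [← this, ← segCoord_spec h]

/-- A quotient `-t ≤ 0` would give `p = (t a + b) / (1 + t)`, a point of the segment. So the
principal logarithm of the quotient is holomorphic in `p` off the segment. -/
theorem div_mem_slitPlane_of_notMem_segment {a b p : ℂ} (h : p ∉ segment ℝ a b) :
    (b - p) / (a - p) ∈ Complex.slitPlane := by
  by_contra hs
  rw [Complex.mem_slitPlane_iff, not_or, not_lt, not_not] at hs
  apply h
  by_cases hap : a = p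
  · rw [hap]
    exact left_mem_segment ℝ p b
  set t := -((b - p) / (a - p)).re with ht
  have h1 : (b - p) / (a - p) = -(t : ℂ) := by
    apply Complex.ext
    · simp [ht]
    · simp [hs.2]
  have h2 : b - p = -(t : ℂ) * (a - p) := by
    rw [← h1, div_mul_cancel₀]
    exact sub_ne_zero.2 hap
  have ht0 : 0 ≤ t := by linarith [hs.1]
  have ht1 : (1 + t : ℂ) ≠ 0 := by
    have : (1 + t : ℝ) ≠ 0 := by positivity
    exact_mod_cast this
  refine ⟨t / (1 + t), 1 / (1 + t), by positivity, by positivity, by field_simp; ring, ?_⟩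
  simp only [Complex.real_smul]
  push_cast
  field_simp
  linear_combination h2

namespace TangleDiagram

variable (D : TangleDiagram)

instance : Finite D.G.edgeSet := Subtype.finite

instance : Fintype D.G.edgeSet := Fintype.ofFinite _

variable {D}

theorem ne_of_adj {a b : D.V} (h : D.G.Adj a b) : (a : ℂ) ≠ b := fun h' => h.ne (Subtype.ext h')

theorem carrier_eq_iUnion : D.carrier =
    ⋃ d : D.G.Dart, segment ℝ (d.fst : ℂ) d.snd := by
  ext z
  simp only [carrier, Set.mem_ofPred_eq, Set.mem_iUnion]
  exact ⟨fun ⟨a, b, h, hz⟩ => ⟨⟨(a, b), h⟩, hz⟩, fun ⟨d, hz⟩ => ⟨_, _, d.adj, hz⟩⟩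

theorem isClosed_segment (a b : ℂ) : IsClosed (segment ℝ a b) := by
  rw [segment_eq_image']
  exact (isCompact_Icc.image (by fun_prop)).isClosed

theorem isClosed_carrier : IsClosed D.carrier := by
  rw [carrier_eq_iUnion]
  exact isClosed_iUnion_of_finite fun d => isClosed_segment _ _

theorem segment_subset_carrier {a b : D.V} (h : D.G.Adj a b) :
    segment ℝ (a : ℂ) b ⊆ D.carrier := fun _ hz => ⟨a, b, h, hz⟩

theorem carrier_subset_closedBall : D.carrier ⊆ Metric.closedBall 0 1 := by
  rintro z ⟨a, b, -, hz⟩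
  refine (convex_closedBall (0 : ℂ) 1).segment_subset ?_ ?_ hz
  · simpa using D.norm_le a
  · simpa using D.norm_le b

theorem vertex_mem_carrier (v : D.V) : (v : ℂ) ∈ D.carrier := by
  obtain ⟨w, hw⟩ := exists_adj v
  exact segment_subset_carrier hw (left_mem_segment ℝ _ _)

theorem eventually_notMem_other_segments {a b : D.V} (h : D.G.Adj a b) {x : ℂ}
    (hx : x ∈ openSegment ℝ (a : ℂ) b) :
    ∀ᶠ p in 𝓝 x, ∀ d : D.G.Dart, s(a, b) ≠ d.edge → p ∉ segment ℝ (d.fst : ℂ) d.snd := by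
  rw [eventually_all]
  intro d
  rw [eventually_imp_distrib_left]
  intro hd
  refine (isClosed_segment _ _).isOpen_compl.mem_nhds ?_
  exact Set.disjoint_left.1 (D.embedded a b d.fst d.snd h d.adj hd) hx

theorem eventually_mem_carrier_iff {a b : D.V} (h : D.G.Adj a b) {x : ℂ}
    (hx : x ∈ openSegment ℝ (a : ℂ) b) :
    ∀ᶠ p in 𝓝 x, (p ∈ D.carrier ↔ (segCoord a b p).im = 0) := by
  have hab := ne_of_adj h
  have hx' := (mem_openSegment_iff_segCoord hab).1 hx
  have h1 : ∀ᶠ p in 𝓝 x, (segCoord a b p).re ∈ Set.Ioo (0 : ℝ) 1 :=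
    (Complex.continuous_re.comp (continuous_segCoord a b)).continuousAt.eventually
      (isOpen_Ioo.mem_nhds hx'.2)
  filter_upwards [h1, eventually_notMem_other_segments h hx] with p hp1 hp2
  constructor
  · rw [carrier_eq_iUnion, Set.mem_iUnion]
    rintro ⟨d, hd⟩
    by_cases he : s(a, b) = d.edge
    · have h2 : p ∈ segment ℝ (a : ℂ) b := by
        rcases Sym2.eq_iff.1 he with ⟨h3, h4⟩ | ⟨h3, h4⟩
        · rw [h3, h4]; exact hd
        · rw [h3, h4, segment_symm]; exact hd
      exact ((mem_segment_iff_segCoord hab).1 h2).1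
    · exact absurd hd (hp2 d he)
  · intro him
    exact segment_subset_carrier h ((mem_segment_iff_segCoord hab).2 ⟨him, hp1.1.le, hp1.2.le⟩)

/-- The function is locally constant off the diagram. -/
def LocConstOff (D : TangleDiagram) {Y : Type*} (f : ℂ → Y) : Prop :=
  ∀ p ∉ D.carrier, ∀ᶠ q in 𝓝 p, f q = f p

theorem LocConstOff.eq_of_isPreconnected {Y : Type*} {f : ℂ → Y} (hf : D.LocConstOff f)
    {C : Set ℂ} (hC : IsPreconnected C) (hCD : Disjoint C D.carrier) {x y : ℂ} (hx : x ∈ C)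
    (hy : y ∈ C) : f x = f y := by
  have : Nonempty Y := ⟨f x⟩
  have hCD' : C ⊆ D.carrierᶜ := Set.disjoint_left.1 hCD
  obtain ⟨c, hc⟩ := hC.exists_eventually_eq (hCD'.trans subset_closure)
    fun z hz => ⟨f z, mem_nhdsWithin_of_mem_nhds (hf z (hCD' hz))⟩
  rw [(hc x hx).self_of_nhdsWithin (hCD' hx), (hc y hy).self_of_nhdsWithin (hCD' hy)]

theorem face_subset {F : Set ℂ} (hF : F ∈ D.faces) :
    F ⊆ Metric.closedBall 0 1 \ D.carrier := by
  obtain ⟨z, hz, rfl⟩ := hF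
  exact connectedComponentIn_subset _ _

theorem disjoint_face_carrier {F : Set ℂ} (hF : F ∈ D.faces) : Disjoint F D.carrier :=
  Set.disjoint_left.2 fun _ hz => (face_subset hF hz).2

theorem isPreconnected_face {F : Set ℂ} (hF : F ∈ D.faces) : IsPreconnected F := by
  obtain ⟨z, hz, rfl⟩ := hF
  exact isPreconnected_connectedComponentIn

theorem face_nonempty {F : Set ℂ} (hF : F ∈ D.faces) : F.Nonempty := by
  obtain ⟨z, hz, rfl⟩ := hF
  exact ⟨z, mem_connectedComponentIn hz⟩

/-- A locally constant function that vanishes on the interior faces and outside the open disk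
vanishes off the diagram. -/
theorem LocConstOff.eq_zero {Y : Type*} [Zero Y] {f : ℂ → Y} (hf : D.LocConstOff f)
    (hout : ∀ p ∉ D.carrier, 1 ≤ ‖p‖ → f p = 0)
    (hint : ∀ F ∈ D.interiorFaces, ∃ p ∈ F, f p = 0) {p : ℂ} (hp : p ∉ D.carrier) : f p = 0 := by
  by_cases hp1 : 1 ≤ ‖p‖
  · exact hout p hp hp1
  have hmem : p ∈ Metric.closedBall (0 : ℂ) 1 \ D.carrier := ⟨by simpa using (not_le.1 hp1).le, hp⟩
  set F := connectedComponentIn (Metric.closedBall (0 : ℂ) 1 \ D.carrier) p with hFdef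
  have hF : F ∈ D.faces := ⟨p, hmem, rfl⟩
  have hpF : p ∈ F := mem_connectedComponentIn hmem
  have key : ∀ q ∈ F, f p = f q := fun q hq =>
    hf.eq_of_isPreconnected (isPreconnected_face hF) (disjoint_face_carrier hF) hpF hq
  by_cases hd : Disjoint F (Metric.sphere (0 : ℂ) 1)
  · obtain ⟨q, hq, hq0⟩ := hint F ⟨hF, hd⟩
    rw [key q hq, hq0]
  · obtain ⟨q, hq, hq1⟩ := Set.not_disjoint_iff.1 hd
    rw [key q hq]
    refine hout q (face_subset hF hq).2 ?_
    rw [mem_sphere_zero_iff_norm] at hq1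
    exact hq1.ge

end TangleDiagram

end

/-! ### Winding numbers: at least `E - V + c` interior faces -/

noncomputable section

open Module Topology Filter

namespace TangleDiagram

variable {D : TangleDiagram}

/-- The sum of the logarithmic angles that the oriented edges subtend, weighted by `z`. For a cycle
`z` this is `2πi` times its winding number. -/
def winding (z : D.G.edgeSet → ℂ) (p : ℂ) : ℂ :=
  ∑ e, z e * Complex.log (((D.G.tgt e : ℂ) - p) / ((D.G.src e : ℂ) - p))

theorem notMem_segment_edge {p : ℂ} (hp : p ∉ D.carrier) (e : D.G.edgeSet) :
    p ∉ segment ℝ (D.G.src e : ℂ) (D.G.tgt e) :=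
  fun h => hp (segment_subset_carrier (D.G.adj_src_tgt e) h)

theorem vertex_sub_ne_zero {p : ℂ} (hp : p ∉ D.carrier) (v : D.V) : (v : ℂ) - p ≠ 0 := by
  intro h
  apply hp
  rw [← sub_eq_zero.1 h]
  exact vertex_mem_carrier v

theorem hasDerivAt_winding (z : D.G.edgeSet → ℂ) {p : ℂ} (hp : p ∉ D.carrier) :
    HasDerivAt (winding z)
      (∑ e, z e * (((D.G.src e : ℂ) - p)⁻¹ - ((D.G.tgt e : ℂ) - p)⁻¹)) p := by
  unfold winding
  refine HasDerivAt.fun_sum fun e _ => HasDerivAt.const_mul _ ?_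
  have ha := vertex_sub_ne_zero hp (D.G.src e)
  have hb := vertex_sub_ne_zero hp (D.G.tgt e)
  have h1 : HasDerivAt (fun p : ℂ => ((D.G.tgt e : ℂ) - p) / ((D.G.src e : ℂ) - p)) _ p :=
    ((hasDerivAt_id p).const_sub _).div ((hasDerivAt_id p).const_sub _) ha
  have h2 := h1.clog (div_mem_slitPlane_of_notMem_segment (notMem_segment_edge hp e))
  refine h2.congr_deriv ?_
  simp only [id_eq]
  field_simp
  ring

/-- Regrouped by vertices, the derivative is a sum over `v` of `(v - p)⁻¹` times the boundary of `z`
at `v`, up to sign, and that boundary vanishes for a cycle. -/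
theorem locConstOff_winding {z : D.G.edgeSet → ℂ} (hz : z ∈ D.G.cycleSpace ℂ) :
    D.LocConstOff (winding z) := by
  have hderiv : ∀ p ∉ D.carrier, HasDerivAt (winding z) 0 p := by
    intro p hp
    convert hasDerivAt_winding z hp using 1
    rw [SimpleGraph.mem_cycleSpace] at hz
    have h1 : ∀ e : D.G.edgeSet, z e * (((D.G.src e : ℂ) - p)⁻¹ - ((D.G.tgt e : ℂ) - p)⁻¹) =
        -∑ v : D.V, ((v : ℂ) - p)⁻¹ * (D.G.orientedInc ℂ e v * z e) := by
      intro e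
      have h2 := D.G.orientedInc_mulVec (K := ℂ) (fun v : D.V => ((v : ℂ) - p)⁻¹) e
      rw [Matrix.mulVec, dotProduct] at h2
      rw [← neg_sub, ← h2, mul_neg, Finset.mul_sum]
      congr 1
      refine Finset.sum_congr rfl fun v _ => ?_
      ring
    rw [Finset.sum_congr rfl fun e _ => h1 e, Finset.sum_neg_distrib, Finset.sum_comm]
    simp_rw [← Finset.mul_sum, hz]
    simp
  intro p hp
  obtain ⟨ε, hε, hball⟩ := Metric.isOpen_iff.1 isClosed_carrier.isOpen_compl p hp
  filter_upwards [Metric.ball_mem_nhds p hε] with q hq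
  refine Metric.isOpen_ball.is_const_of_deriv_eq_zero (convex_ball p ε).isPreconnected
    (fun w hw => (hderiv w (hball hw)).differentiableAt.differentiableWithinAt)
    (fun w hw => (hderiv w (hball hw)).deriv) hq (Metric.mem_ball_self hε)

theorem tendsto_winding_cobounded (z : D.G.edgeSet → ℂ) :
    Tendsto (winding z) (Bornology.cobounded ℂ) (𝓝 0) := by
  have h0 : (0 : ℂ) = ∑ e : D.G.edgeSet, z e * Complex.log 1 := by simp
  rw [h0]
  refine tendsto_finsetSum _ fun e _ => Tendsto.const_mul _ ?_
  refine ((continuousAt_clog ?_).tendsto).comp ?_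
  · exact Complex.one_mem_slitPlane
  set a : ℂ := (D.G.src e : ℂ)
  set b : ℂ := (D.G.tgt e : ℂ)
  have h1 : Tendsto (fun p : ℂ => a - p) (Bornology.cobounded ℂ) (Bornology.cobounded ℂ) := by
    rw [← tendsto_norm_atTop_iff_cobounded]
    refine tendsto_atTop_mono (fun p => ?_)
      (tendsto_atTop_add_const_right _ (-‖a‖) tendsto_norm_cobounded_atTop)
    have := norm_sub_norm_le p a
    rw [norm_sub_rev] at this
    linarith
  have h2 : Tendsto (fun p : ℂ => 1 + (b - a) * (a - p)⁻¹) (Bornology.cobounded ℂ)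
      (𝓝 (1 + (b - a) * 0)) :=
    Tendsto.const_add _ (Tendsto.const_mul _ ((tendsto_inv₀_cobounded (α := ℂ)).comp h1))
  rw [mul_zero, add_zero] at h2
  refine h2.congr' ?_
  filter_upwards [h1.eventually (Bornology.eventually_ne_cobounded (0 : ℂ))] with p hp
  field_simp
  ring

theorem ray_disjoint_carrier {p : ℂ} (hp : p ∉ D.carrier) (hp1 : 1 ≤ ‖p‖) :
    Disjoint ((fun t : ℝ => t • p) '' Set.Ici 1) D.carrier := by
  rw [Set.disjoint_left]
  rintro _ ⟨t, ht, rfl⟩ h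
  rcases eq_or_lt_of_le (Set.mem_Ici.1 ht) with rfl | ht'
  · simp only [one_smul] at h
    exact hp h
  · have h1 := carrier_subset_closedBall h
    rw [mem_closedBall_zero_iff, norm_smul, Real.norm_of_nonneg (by linarith)] at h1
    nlinarith

/-- The radial ray from `p` to infinity misses the diagram, so the winding number is constant along
it, and it tends to `0`. -/
theorem winding_eq_zero_of_one_le_norm {z : D.G.edgeSet → ℂ} (hz : z ∈ D.G.cycleSpace ℂ) {p : ℂ}
    (hp : p ∉ D.carrier) (hp1 : 1 ≤ ‖p‖) : winding z p = 0 := by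
  have hC : IsPreconnected ((fun t : ℝ => t • p) '' Set.Ici 1) :=
    isPreconnected_Ici.image _ (by fun_prop)
  have h1 : Tendsto (fun t : ℝ => t • p) atTop (Bornology.cobounded ℂ) := by
    rw [← tendsto_norm_atTop_iff_cobounded]
    refine tendsto_atTop_mono' _ ?_ tendsto_id
    filter_upwards [eventually_ge_atTop 0] with t ht
    rw [norm_smul, Real.norm_of_nonneg ht, id]
    nlinarith
  have h2 := (tendsto_winding_cobounded z).comp h1
  refine tendsto_nhds_unique ?_ h2
  refine tendsto_const_nhds.congr' ?_
  filter_upwards [eventually_ge_atTop 1] with t ht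
  exact (locConstOff_winding hz).eq_of_isPreconnected hC (ray_disjoint_carrier hp hp1)
    ⟨1, Set.self_mem_Ici, by simp⟩ ⟨t, ht, rfl⟩

/-- Crossing the edge `e` at its midpoint, the logarithm belonging to `e` jumps by `2πi` while all
other terms are continuous; hence `z e * 2πi = 0`. -/
theorem eq_zero_of_winding_eq_zero {z : D.G.edgeSet → ℂ}
    (h : ∀ p ∉ D.carrier, winding z p = 0) : z = 0 := by
  classical
  ext e
  have hadj := D.G.adj_src_tgt e
  have hab := ne_of_adj hadj
  set a : ℂ := (D.G.src e : ℂ) with ha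
  set b : ℂ := (D.G.tgt e : ℂ) with hb
  have hba : b - a ≠ 0 := sub_ne_zero.2 hab.symm
  -- The perpendicular bisector of the edge, at its midpoint for `t = 0`.
  let γ : ℝ → ℂ := fun t => a + (1 / 2 + t * Complex.I) * (b - a)
  have hγ : Continuous γ := by fun_prop
  have hcoord : ∀ t, segCoord a b (γ t) = 1 / 2 + t * Complex.I := by
    intro t
    simp only [segCoord, γ]
    field_simp
    ring
  have hm : γ 0 ∈ openSegment ℝ a b := by
    rw [mem_openSegment_iff_segCoord hab, hcoord]
    norm_num
  have hoff : ∀ᶠ t : ℝ in 𝓝 0, t ≠ 0 → γ t ∉ D.carrier := by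
    filter_upwards [hγ.continuousAt.eventually (eventually_mem_carrier_iff hadj hm)] with t ht ht0
    rw [ht, hcoord]
    simpa using ht0
  let rest : ℝ → ℂ := fun t => ∑ e' ∈ Finset.univ.erase e,
    z e' * Complex.log (((D.G.tgt e' : ℂ) - γ t) / ((D.G.src e' : ℂ) - γ t))
  have hrest : ContinuousAt rest 0 := by
    refine tendsto_finsetSum _ fun e' he' => ?_
    have hne : e' ≠ e := Finset.ne_of_mem_erase he'
    have hnot : γ 0 ∉ segment ℝ (D.G.src e' : ℂ) (D.G.tgt e') := by
      refine (eventually_notMem_other_segments hadj hm).self_of_nhds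
        ⟨(D.G.src e', D.G.tgt e'), D.G.adj_src_tgt e'⟩ ?_
      change s(D.G.src e, D.G.tgt e) ≠ s(D.G.src e', D.G.tgt e')
      rw [D.G.mk_src_tgt, D.G.mk_src_tgt]
      exact fun h' => hne (Subtype.ext h'.symm)
    have hs : (D.G.src e' : ℂ) - γ 0 ≠ 0 := by
      intro h'
      apply hnot
      rw [← sub_eq_zero.1 h']
      exact left_mem_segment ℝ _ _
    refine Tendsto.const_mul _ ?_
    refine ContinuousAt.clog ?_ (div_mem_slitPlane_of_notMem_segment hnot)
    exact (continuousAt_const.sub hγ.continuousAt).div (continuousAt_const.sub hγ.continuousAt) hs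
  let W : ℝ → ℂ := fun t => (b - γ t) / (a - γ t)
  have hW0 : W 0 = -1 := by
    simp only [W, γ]
    push_cast
    rw [div_eq_iff]
    · ring
    · simpa using hba
  have hWc : ContinuousAt W 0 := by
    refine (continuousAt_const.sub hγ.continuousAt).div (continuousAt_const.sub hγ.continuousAt) ?_
    simpa [γ] using hba
  -- The imaginary part of `W t` has the sign of `t`, so `W` reaches `-1` from opposite sides of the
  -- branch cut.
  have hWim : ∀ t : ℝ, (W t).im = t / (1 / 4 + t ^ 2) := by
    intro t
    have h1 : (1 / 2 + t * Complex.I : ℂ) ≠ 0 := by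
      intro h'
      have := congrArg Complex.re h'
      norm_num at this
    have h2 : W t = -(1 / 2 - t * Complex.I) ^ 2 / (((1 / 4 + t ^ 2 : ℝ)) : ℂ) := by
      have h3 : (1 / 4 + t ^ 2 : ℝ) ≠ 0 := by positivity
      have h3' : (((1 / 4 + t ^ 2 : ℝ)) : ℂ) ≠ 0 := by exact_mod_cast h3
      have h4 : (((1 / 4 + t ^ 2 : ℝ)) : ℂ) = (1 / 2 + t * Complex.I) * (1 / 2 - t * Complex.I) := by
        push_cast
        linear_combination ((t : ℂ) ^ 2) * Complex.I_sq
      have h5 : (1 / 2 - t * Complex.I : ℂ) ≠ 0 := right_ne_zero_of_mul (h4 ▸ h3')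
      rw [h4]
      simp only [W, γ]
      have h6 : a - (a + (1 / 2 + t * Complex.I) * (b - a)) =
        -((1 / 2 + t * Complex.I) * (b - a)) := by ring
      rw [h6, div_eq_div_iff (neg_ne_zero.2 (mul_ne_zero h1 hba)) (mul_ne_zero h1 h5)]
      ring
    rw [h2, Complex.div_ofReal_im]
    congr 1
    simp [pow_two]
    ring
  have hsum : ∀ t, winding z (γ t) = z e * Complex.log (W t) + rest t := by
    intro t
    rw [winding, ← Finset.add_sum_erase _ _ (Finset.mem_univ e)]
  have hlim : ∀ (l : Filter ℝ) (c : ℂ), l.NeBot → l ≤ 𝓝 0 → (∀ᶠ t in l, t ≠ 0) →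
      Tendsto (fun t => Complex.log (W t)) l (𝓝 c) → z e * c + rest 0 = 0 := by
    intro l c _ hl hl0 hc
    refine tendsto_nhds_unique ((hc.const_mul (z e)).add (hrest.mono_left hl)) ?_
    refine tendsto_const_nhds.congr' ?_
    filter_upwards [hl hoff, hl0] with t ht ht0
    rw [← hsum, h _ (ht ht0)]
  have hup := hlim (𝓝[>] 0) (Real.log ‖(-1 : ℂ)‖ + Real.pi * Complex.I) inferInstance
    nhdsWithin_le_nhds (by filter_upwards [self_mem_nhdsWithin] with t ht using ne_of_gt ht) (by
      refine (Complex.tendsto_log_nhdsWithin_im_nonneg_of_re_neg_of_im_zero (z := -1)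
        (by norm_num) (by norm_num)).comp ?_
      refine tendsto_nhdsWithin_iff.2 ⟨?_, ?_⟩
      · rw [← hW0]
        exact hWc.tendsto.mono_left nhdsWithin_le_nhds
      · filter_upwards [self_mem_nhdsWithin] with t ht
        have ht : 0 < t := ht
        change 0 ≤ (W t).im
        rw [hWim]
        positivity)
  have hdown := hlim (𝓝[<] 0) (Real.log ‖(-1 : ℂ)‖ - Real.pi * Complex.I) inferInstance
    nhdsWithin_le_nhds (by filter_upwards [self_mem_nhdsWithin] with t ht using ne_of_lt ht) (by
      refine (Complex.tendsto_log_nhdsWithin_im_neg_of_re_neg_of_im_zero (z := -1)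
        (by norm_num) (by norm_num)).comp ?_
      refine tendsto_nhdsWithin_iff.2 ⟨?_, ?_⟩
      · rw [← hW0]
        exact hWc.tendsto.mono_left nhdsWithin_le_nhds
      · filter_upwards [self_mem_nhdsWithin] with t ht
        have ht : t < 0 := ht
        change (W t).im < 0
        rw [hWim]
        exact div_neg_of_neg_of_pos ht (by positivity))
  have hfin : z e * (2 * Real.pi * Complex.I) = 0 := by linear_combination hup - hdown
  exact (mul_eq_zero.1 hfin).resolve_right Complex.two_pi_I_ne_zero

theorem finrank_cycleSpace_le_numInteriorFaces (hfin : D.interiorFaces.Finite) :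
    finrank ℂ (D.G.cycleSpace ℂ) ≤ D.numInteriorFaces := by
  have := hfin.fintype
  have hne : ∀ F : D.interiorFaces, (F : Set ℂ).Nonempty := fun F => face_nonempty F.2.1
  choose pt hpt using hne
  let φ : (D.G.edgeSet → ℂ) →ₗ[ℂ] (D.interiorFaces → ℂ) :=
    { toFun := fun z F => winding z (pt F)
      map_add' := fun z w => by
        ext F
        simp [winding, add_mul, Finset.sum_add_distrib]
      map_smul' := fun c z => by
        ext F
        simp [winding, mul_assoc, Finset.mul_sum] }
  have hφ : Function.Injective (φ.domRestrict (D.G.cycleSpace ℂ)) := by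
    rw [← LinearMap.ker_eq_bot, LinearMap.ker_eq_bot']
    rintro ⟨z, hz⟩ h
    refine Subtype.ext (eq_zero_of_winding_eq_zero fun p hp => ?_)
    refine (locConstOff_winding hz).eq_zero
      (fun p hp hp1 => winding_eq_zero_of_one_le_norm hz hp hp1) (fun F hF => ?_) hp
    exact ⟨pt ⟨F, hF⟩, hpt ⟨F, hF⟩, congrFun h ⟨F, hF⟩⟩
  have h1 := LinearMap.finrank_le_finrank_of_injective hφ
  rwa [finrank_fintype_fun_eq_card, ← Nat.card_eq_fintype_card, Nat.card_coe_set_eq] at h1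

end TangleDiagram

end

/-! ### Mod 2 functions on the faces and their jumps across edges -/

noncomputable section

open Module Topology Filter

theorem segCoord_combo (a b x y : ℂ) {s t : ℝ} (hst : s + t = 1) :
    segCoord a b (s • x + t • y) = s * segCoord a b x + t * segCoord a b y := by
  have h : (s : ℂ) + t = 1 := by exact_mod_cast hst
  unfold segCoord
  simp only [Complex.real_smul]
  rw [← mul_div_assoc, ← mul_div_assoc, ← add_div]
  congr 1
  linear_combination a * h

/-- The open half-plane to the left of the line from `a` to `b`. -/
def leftSide (a b : ℂ) : Set ℂ := {p | 0 < (segCoord a b p).im}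

theorem convex_leftSide (a b : ℂ) : Convex ℝ (leftSide a b) := by
  intro x hx y hy s t hs ht hst
  have hx : 0 < (segCoord a b x).im := hx
  have hy : 0 < (segCoord a b y).im := hy
  change 0 < (segCoord a b (s • x + t • y)).im
  rw [segCoord_combo a b x y hst]
  simp only [Complex.add_im, Complex.im_ofReal_mul]
  rcases hs.eq_or_lt with rfl | hs
  · obtain rfl : t = 1 := by linarith
    linarith
  · have := mul_pos hs hx
    have := mul_nonneg ht hy.le
    linarith

theorem openSegment_subset_closure_leftSide {a b : ℂ} (hab : a ≠ b) :
    openSegment ℝ a b ⊆ closure (leftSide a b) := by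
  intro x hx
  have hx' := (mem_openSegment_iff_segCoord hab).1 hx
  have hba : b - a ≠ 0 := sub_ne_zero.2 hab.symm
  let γ : ℝ → ℂ := fun t => x + t * Complex.I * (b - a)
  have hγ : Tendsto γ (𝓝[>] 0) (𝓝 x) := by
    have h0 : γ 0 = x := by simp [γ]
    have h1 : Continuous γ := by fun_prop
    have h2 := h1.tendsto 0
    rw [h0] at h2
    exact h2.mono_left nhdsWithin_le_nhds
  refine mem_closure_of_tendsto hγ ?_
  filter_upwards [self_mem_nhdsWithin] with t ht
  have ht : 0 < t := ht
  change 0 < (segCoord a b (γ t)).im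
  have : segCoord a b (γ t) = segCoord a b x + t * Complex.I := by
    simp only [segCoord, γ]
    field_simp
    ring
  rw [this]
  simp [hx'.1, ht]

namespace TangleDiagram

variable {D : TangleDiagram}

/-- The function takes the value `l` on the left side of the dart. -/
def IsLeftValue (f : ℂ → ZMod 2) (d : D.G.Dart) (l : ZMod 2) : Prop :=
  ∀ x ∈ openSegment ℝ (d.fst : ℂ) d.snd,
    ∀ᶠ p in 𝓝[leftSide (d.fst : ℂ) d.snd] x, f p = l

/-- Near a point of the open segment, the left half of a small ball is convex and misses the
diagram. -/
theorem LocConstOff.exists_isLeftValue {f : ℂ → ZMod 2} (hf : D.LocConstOff f) (d : D.G.Dart) :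
    ∃ l, IsLeftValue f d l := by
  have hab := ne_of_adj d.adj
  refine (convex_openSegment _ _).isPreconnected.exists_eventually_eq
    (openSegment_subset_closure_leftSide hab) fun x hx => ?_
  obtain ⟨ε, hε, hball⟩ := Metric.eventually_nhds_iff_ball.1 (eventually_mem_carrier_iff d.adj hx)
  have hC : IsPreconnected (Metric.ball x ε ∩ leftSide (d.fst : ℂ) d.snd) :=
    ((convex_ball x ε).inter (convex_leftSide _ _)).isPreconnected
  have hdis : Disjoint (Metric.ball x ε ∩ leftSide (d.fst : ℂ) d.snd) D.carrier := by
    rw [Set.disjoint_left]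
    rintro p ⟨hp1, hp2⟩ hp
    exact (ne_of_gt hp2) ((hball p hp1).1 hp)
  obtain ⟨q, hq1, hq2⟩ := mem_closure_iff.1 (openSegment_subset_closure_leftSide hab hx)
    (Metric.ball x ε) Metric.isOpen_ball (Metric.mem_ball_self hε)
  refine ⟨f q, ?_⟩
  filter_upwards [mem_nhdsWithin_of_mem_nhds (Metric.ball_mem_nhds x hε), self_mem_nhdsWithin]
    with p hp1 hp2
  exact hf.eq_of_isPreconnected hC hdis ⟨hp1, hp2⟩ ⟨hq1, hq2⟩

theorem IsLeftValue.unique {f : ℂ → ZMod 2} {d : D.G.Dart} {l l' : ZMod 2}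
    (h : IsLeftValue f d l) (h' : IsLeftValue f d l') : l = l' := by
  have hab := ne_of_adj d.adj
  obtain ⟨x, hx⟩ : (openSegment ℝ (d.fst : ℂ) d.snd).Nonempty :=
    ⟨_, 1 / 2, 1 / 2, by norm_num, by norm_num, by norm_num, rfl⟩
  have := mem_closure_iff_nhdsWithin_neBot.1 (openSegment_subset_closure_leftSide hab hx)
  obtain ⟨p, hp, hp'⟩ := ((h x hx).and (h' x hx)).exists
  exact hp.symm.trans hp'

open Classical in
/-- The value on the left side of a dart. -/
def leftValue (f : ℂ → ZMod 2) (d : D.G.Dart) : ZMod 2 :=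
  if h : ∃ l, IsLeftValue f d l then h.choose else 0

theorem LocConstOff.isLeftValue {f : ℂ → ZMod 2} (hf : D.LocConstOff f) (d : D.G.Dart) :
    IsLeftValue f d (leftValue f d) := by
  rw [leftValue, dif_pos (hf.exists_isLeftValue d)]
  exact (hf.exists_isLeftValue d).choose_spec

theorem IsLeftValue.leftValue_eq {f : ℂ → ZMod 2} {d : D.G.Dart} {l : ZMod 2}
    (h : IsLeftValue f d l) : leftValue f d = l := by
  have h' : ∃ l, IsLeftValue f d l := ⟨l, h⟩
  rw [leftValue, dif_pos h']
  exact h'.choose_spec.unique h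

/-- The jump across an edge. -/
def jump (f : ℂ → ZMod 2) (e : D.G.edgeSet) : ZMod 2 :=
  leftValue f ⟨(D.G.src e, D.G.tgt e), D.G.adj_src_tgt e⟩ +
    leftValue f ⟨(D.G.tgt e, D.G.src e), (D.G.adj_src_tgt e).symm⟩

theorem jump_seg (f : ℂ → ZMod 2) (d : D.G.Dart) :
    jump f (seg d) = leftValue f d + leftValue f d.symm := by
  have h : seg (D := D) ⟨(D.G.src (seg d), D.G.tgt (seg d)), D.G.adj_src_tgt (seg d)⟩ = seg d :=
    Subtype.ext (D.G.mk_src_tgt (seg d))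
  have h' : ∀ d₀ : D.G.Dart, d₀ = d ∨ d₀ = d.symm →
      leftValue f d₀ + leftValue f d₀.symm = leftValue f d + leftValue f d.symm := by
    rintro d₀ (rfl | rfl)
    · rfl
    · rw [SimpleGraph.Dart.symm_symm, add_comm]
  exact h' _ (seg_eq_iff.1 h)

theorem jump_add {f g : ℂ → ZMod 2} (hf : D.LocConstOff f) (hg : D.LocConstOff g)
    (e : D.G.edgeSet) : jump (f + g) e = jump f e + jump g e := by
  have key : ∀ d : D.G.Dart, leftValue (f + g) d = leftValue f d + leftValue g d := by
    intro d
    apply IsLeftValue.leftValue_eq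
    intro x hx
    filter_upwards [hf.isLeftValue d x hx, hg.isLeftValue d x hx] with p h1 h2
    simp [h1, h2]
  simp only [jump, key]
  ring

theorem im_segCoord_swap {a b : ℂ} (h : a ≠ b) (p : ℂ) :
    (segCoord b a p).im = -(segCoord a b p).im := by
  rw [segCoord_swap h]
  simp

/-- Near an edge, the values on the two sides. -/
theorem LocConstOff.eventually_side {f : ℂ → ZMod 2} (hf : D.LocConstOff f) (d : D.G.Dart) {x : ℂ}
    (hx : x ∈ openSegment ℝ (d.fst : ℂ) d.snd) :
    ∀ᶠ p in 𝓝 x, (0 < (segCoord (d.fst : ℂ) d.snd p).im → f p = leftValue f d) ∧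
      ((segCoord (d.fst : ℂ) d.snd p).im < 0 → f p = leftValue f d.symm) := by
  have h1 := eventually_nhdsWithin_iff.1 (hf.isLeftValue d x hx)
  have h2 := eventually_nhdsWithin_iff.1
    (hf.isLeftValue d.symm x (by rw [openSegment_symm] at hx; exact hx))
  filter_upwards [h1, h2] with p h1 h2
  refine ⟨h1, fun h => h2 ?_⟩
  change 0 < (segCoord (d.snd : ℂ) d.fst p).im
  rw [im_segCoord_swap (ne_of_adj d.adj)]
  linarith

theorem mem_openSegment_of_mem_carrier {x : ℂ} (hx : x ∈ D.carrier) (hV : x ∉ D.V) :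
    ∃ d : D.G.Dart, x ∈ openSegment ℝ (d.fst : ℂ) d.snd := by
  obtain ⟨a, b, hab, h⟩ := hx
  refine ⟨⟨(a, b), hab⟩, mem_openSegment_of_ne_left_right ?_ ?_ h⟩
  · rintro rfl
    exact hV a.2
  · rintro rfl
    exact hV b.2

/-- Without jumps the function extends over the open segments to the plane minus the finite vertex
set, which is connected. Its constant value is read off at `2`, outside the disk. -/
theorem LocConstOff.eq_zero_of_jump {f : ℂ → ZMod 2} (hf : D.LocConstOff f)
    (hj : ∀ e : D.G.edgeSet, jump f e = 0) (hout : ∀ p ∉ D.carrier, 1 ≤ ‖p‖ → f p = 0) {p : ℂ}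
    (hp : p ∉ D.carrier) : f p = 0 := by
  have hC : IsPreconnected ((D.V : Set ℂ)ᶜ) := by
    refine (Set.Countable.isPathConnected_compl_of_one_lt_rank ?_
      D.V.countable_toSet).isConnected.isPreconnected
    rw [Complex.rank_real_complex]
    norm_num
  have hedge : ∀ x ∉ (D.V : Set ℂ), x ∈ D.carrier → x ∈ closure D.carrierᶜ ∧
      ∃ c, ∀ᶠ q in 𝓝[D.carrierᶜ] x, f q = c := by
    intro x hxV hx
    obtain ⟨d, hd⟩ := mem_openSegment_of_mem_carrier hx hxV
    have hab := ne_of_adj d.adj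
    constructor
    · have := mem_closure_iff_nhdsWithin_neBot.1 (openSegment_subset_closure_leftSide hab hd)
      rw [mem_closure_iff_frequently]
      have h1 : ∀ᶠ p in 𝓝[leftSide (d.fst : ℂ) d.snd] x, p ∈ D.carrierᶜ := by
        filter_upwards [mem_nhdsWithin_of_mem_nhds (eventually_mem_carrier_iff d.adj hd),
          self_mem_nhdsWithin] with p hp1 hp2 hp3
        exact (ne_of_gt hp2) (hp1.1 hp3)
      exact h1.frequently.filter_mono nhdsWithin_le_nhds
    · refine ⟨leftValue f d, ?_⟩
      have h0 := hj (seg d)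
      rw [jump_seg] at h0
      have h1 : leftValue f d.symm = leftValue f d := (CharTwo.add_eq_zero.1 h0).symm
      filter_upwards [mem_nhdsWithin_of_mem_nhds (eventually_mem_carrier_iff d.adj hd),
          mem_nhdsWithin_of_mem_nhds (hf.eventually_side d hd), self_mem_nhdsWithin]
        with q hq1 hq2 hq3
      have hne : (segCoord (d.fst : ℂ) d.snd q).im ≠ 0 := fun h => hq3 (hq1.2 h)
      rcases lt_or_gt_of_ne hne with h | h
      · rw [hq2.2 h, h1]
      · exact hq2.1 h
  obtain ⟨c, hc⟩ := hC.exists_eventually_eq (T := D.carrierᶜ) (f := f)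
    (fun x hx => by
      by_cases h : x ∈ D.carrier
      · exact (hedge x hx h).1
      · exact subset_closure h)
    (fun x hx => by
      by_cases h : x ∈ D.carrier
      · exact (hedge x hx h).2
      · exact ⟨f x, mem_nhdsWithin_of_mem_nhds (hf x h)⟩)
  have hval : ∀ q ∉ D.carrier, f q = c := fun q hq =>
    (hc q fun hqV => hq (vertex_mem_carrier ⟨q, hqV⟩)).self_of_nhdsWithin hq
  have h2 : (2 : ℂ) ∉ D.carrier := fun h => by
    have := carrier_subset_closedBall h
    norm_num at this
  rw [hval p hp, ← hval 2 h2]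
  exact hout 2 h2 (by norm_num)

open Classical in
/-- The function that is given on the interior faces and vanishes elsewhere. -/
def faceFun (h : D.interiorFaces → ZMod 2) (p : ℂ) : ZMod 2 :=
  if H : connectedComponentIn (Metric.closedBall (0 : ℂ) 1 \ D.carrier) p ∈ D.interiorFaces then
    h ⟨_, H⟩ else 0

theorem faceFun_congr (h : D.interiorFaces → ZMod 2) {p q : ℂ}
    (hpq : connectedComponentIn (Metric.closedBall (0 : ℂ) 1 \ D.carrier) p =
      connectedComponentIn (Metric.closedBall (0 : ℂ) 1 \ D.carrier) q) :
    faceFun h p = faceFun h q := by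
  unfold faceFun
  by_cases H : connectedComponentIn (Metric.closedBall (0 : ℂ) 1 \ D.carrier) p ∈ D.interiorFaces
  · rw [dif_pos H, dif_pos (hpq ▸ H)]
    exact congrArg h (Subtype.ext hpq)
  · rw [dif_neg H, dif_neg (hpq ▸ H)]

theorem faceFun_of_mem (h : D.interiorFaces → ZMod 2) (F : D.interiorFaces) {p : ℂ}
    (hp : p ∈ (F : Set ℂ)) : faceFun h p = h F := by
  obtain ⟨⟨z, hz, hF⟩, hd⟩ := F.2
  have h1 : connectedComponentIn (Metric.closedBall (0 : ℂ) 1 \ D.carrier) p = F := by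
    rw [hF] at hp ⊢
    exact (connectedComponentIn_eq hp).symm
  have H : connectedComponentIn (Metric.closedBall (0 : ℂ) 1 \ D.carrier) p ∈ D.interiorFaces := by
    rw [h1]
    exact F.2
  rw [faceFun, dif_pos H]
  exact congrArg h (Subtype.ext h1)

theorem faceFun_eq_zero (h : D.interiorFaces → ZMod 2) {p : ℂ} (hp : 1 ≤ ‖p‖) :
    faceFun h p = 0 := by
  rw [faceFun, dif_neg]
  intro H
  by_cases hmem : p ∈ Metric.closedBall (0 : ℂ) 1 \ D.carrier
  · refine Set.disjoint_left.1 H.2 (mem_connectedComponentIn hmem) ?_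
    rw [mem_sphere_zero_iff_norm]
    exact le_antisymm (by simpa using hmem.1) hp
  · obtain ⟨q, hq⟩ := face_nonempty H.1
    rw [connectedComponentIn_eq_empty hmem] at hq
    exact hq

/-- The delicate points lie on the unit circle. Nearby points in the disk belong to the same face,
which is not interior, and points outside the disk have value `0` as well. -/
theorem locConstOff_faceFun (h : D.interiorFaces → ZMod 2) : D.LocConstOff (faceFun h) := by
  intro p hp
  obtain ⟨ε, hε, hball⟩ := Metric.isOpen_iff.1 isClosed_carrier.isOpen_compl p hp
  have key : ∀ q ∈ Metric.ball p ε, ‖p‖ ≤ 1 → ‖q‖ ≤ 1 → faceFun h q = faceFun h p := by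
    intro q hq hp1 hq1
    apply faceFun_congr
    have hC : IsPreconnected (Metric.ball p ε ∩ Metric.closedBall (0 : ℂ) 1) :=
      ((convex_ball p ε).inter (convex_closedBall _ _)).isPreconnected
    have hsub : Metric.ball p ε ∩ Metric.closedBall (0 : ℂ) 1 ⊆
        Metric.closedBall (0 : ℂ) 1 \ D.carrier := fun w hw => ⟨hw.2, hball hw.1⟩
    refine (connectedComponentIn_eq ?_).symm
    exact hC.subset_connectedComponentIn ⟨Metric.mem_ball_self hε, by simpa using hp1⟩ hsub
      ⟨hq, by simpa using hq1⟩
  rcases lt_or_ge ‖p‖ 1 with hp1 | hp1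
  · have h1 : ∀ᶠ q : ℂ in 𝓝 p, ‖q‖ < 1 := continuous_norm.continuousAt.eventually_lt_const hp1
    filter_upwards [Metric.ball_mem_nhds p hε, h1] with q hq hq1
    exact key q hq hp1.le hq1.le
  · rcases hp1.eq_or_lt with hp1 | hp1
    · filter_upwards [Metric.ball_mem_nhds p hε] with q hq
      rcases le_total ‖q‖ 1 with hq1 | hq1
      · exact key q hq hp1.ge hq1
      · rw [faceFun_eq_zero h hq1, faceFun_eq_zero h hp1.le]
    · have h1 : ∀ᶠ q : ℂ in 𝓝 p, 1 < ‖q‖ := continuous_norm.continuousAt.eventually_const_lt hp1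
      filter_upwards [h1] with q hq1
      rw [faceFun_eq_zero h hq1.le, faceFun_eq_zero h hp1.le]

end TangleDiagram

end

/-! ### Jumps form a cycle: Euler's formula -/

noncomputable section

open Module Topology Filter

theorem circleMap_add_two_pi (c : ℂ) (R θ : ℝ) :
    circleMap c R (θ + 2 * Real.pi) = circleMap c R θ := periodic_circleMap c R θ

theorem segCoord_circleMap {a b : ℂ} (hab : a ≠ b) (R θ : ℝ) :
    segCoord a b (circleMap a R θ) =
      ((R / ‖b - a‖ : ℝ) : ℂ) * Complex.exp ((θ - (b - a).arg : ℝ) * Complex.I) := by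
  have hba : b - a ≠ 0 := sub_ne_zero.2 hab.symm
  have hn : ((‖b - a‖ : ℝ) : ℂ) ≠ 0 := by exact_mod_cast norm_ne_zero_iff.2 hba
  have h1 := Complex.norm_mul_exp_arg_mul_I (b - a)
  have h2 : Complex.exp ((b - a).arg * Complex.I) ≠ 0 := Complex.exp_ne_zero _
  have h3 : Complex.exp ((θ - (b - a).arg : ℝ) * Complex.I) =
      Complex.exp (θ * Complex.I) / Complex.exp ((b - a).arg * Complex.I) := by
    rw [← Complex.exp_sub]
    push_cast
    ring_nf
  unfold segCoord circleMap
  rw [h3, add_sub_cancel_left]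
  conv_lhs => rw [← h1]
  push_cast
  field_simp

theorem segCoord_circleMap_im {a b : ℂ} (hab : a ≠ b) (R θ : ℝ) :
    (segCoord a b (circleMap a R θ)).im = R / ‖b - a‖ * Real.sin (θ - (b - a).arg) := by
  rw [segCoord_circleMap hab, Complex.im_ofReal_mul, Complex.exp_ofReal_mul_I_im]

theorem segCoord_circleMap_re {a b : ℂ} (hab : a ≠ b) (R θ : ℝ) :
    (segCoord a b (circleMap a R θ)).re = R / ‖b - a‖ * Real.cos (θ - (b - a).arg) := by
  rw [segCoord_circleMap hab, Complex.re_ofReal_mul, Complex.exp_ofReal_mul_I_re]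

/-- The number of turns from the direction of `b - a` to the direction `θ`. -/
def turns (a b : ℂ) (θ : ℝ) : ℝ := (θ - (b - a).arg) / (2 * Real.pi)

theorem continuous_turns (a b : ℂ) : Continuous (turns a b) := by
  unfold turns
  fun_prop

theorem turns_add_two_pi (a b : ℂ) (θ : ℝ) : turns a b (θ + 2 * Real.pi) = turns a b θ + 1 := by
  unfold turns
  have := Real.pi_pos
  field_simp
  ring

theorem circleMap_mem_segment_iff {a b : ℂ} (hab : a ≠ b) {R : ℝ} (hR : 0 < R)
    (hRb : R < ‖b - a‖) (θ : ℝ) :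
    circleMap a R θ ∈ segment ℝ a b ↔ ∃ n : ℤ, turns a b θ = n := by
  have hb : 0 < ‖b - a‖ := hR.trans hRb
  have hr : 0 < R / ‖b - a‖ := div_pos hR hb
  have hr1 : R / ‖b - a‖ < 1 := (div_lt_one hb).2 hRb
  have hpi := Real.pi_pos
  have h1 : (∃ n : ℤ, turns a b θ = n) ↔ Real.cos (θ - (b - a).arg) = 1 := by
    rw [Real.cos_eq_one_iff]
    refine exists_congr fun n => ?_
    rw [turns, div_eq_iff (by positivity)]
    exact eq_comm
  rw [h1, mem_segment_iff_segCoord hab, segCoord_circleMap_im hab, segCoord_circleMap_re hab]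
  constructor
  · rintro ⟨h2, h3, -⟩
    have h4 : Real.sin (θ - (b - a).arg) = 0 := (mul_eq_zero.1 h2).resolve_left hr.ne'
    have h5 := Real.sin_sq_add_cos_sq (θ - (b - a).arg)
    rw [h4] at h5
    have h6 : 0 ≤ Real.cos (θ - (b - a).arg) := nonneg_of_mul_nonneg_right h3 hr
    nlinarith
  · intro h2
    have h5 := Real.sin_sq_add_cos_sq (θ - (b - a).arg)
    rw [h2] at h5
    have h4 : Real.sin (θ - (b - a).arg) = 0 := by
      have : Real.sin (θ - (b - a).arg) ^ 2 = 0 := by linarith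
      exact pow_eq_zero_iff two_ne_zero |>.1 this
    rw [h4, h2]
    constructor
    · simp
    · rw [mul_one]
      exact ⟨hr.le, hr1.le⟩

theorem eventually_floor_eq_of_forall_ne {x : ℝ} (hx : ∀ n : ℤ, x ≠ n) :
    ∀ᶠ y in 𝓝 x, ⌊y⌋ = ⌊x⌋ := by
  have h1 : (⌊x⌋ : ℝ) < x := lt_of_le_of_ne (Int.floor_le x) (hx _).symm
  filter_upwards [isOpen_Ioo.mem_nhds ⟨h1, Int.lt_floor_add_one x⟩] with y hy
  rw [Int.floor_eq_iff]
  exact ⟨hy.1.le, hy.2⟩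

theorem floor_eq_of_near_int {n : ℤ} {y : ℝ} (hy : |y - n| < 1) :
    (n ≤ y → ⌊y⌋ = n) ∧ (y < n → ⌊y⌋ = n - 1) := by
  rw [abs_lt] at hy
  refine ⟨fun h => Int.floor_eq_iff.2 ⟨h, by linarith⟩, fun h => Int.floor_eq_iff.2 ⟨?_, ?_⟩⟩
  · push_cast
    linarith
  · push_cast
    linarith

namespace TangleDiagram

variable {D : TangleDiagram}

theorem vertex_notMem_segment {v a b : D.V} (h : D.G.Adj a b) (ha : v ≠ a) (hb : v ≠ b) :
    (v : ℂ) ∉ segment ℝ (a : ℂ) b := by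
  intro hv
  have hv' : (v : ℂ) ∈ openSegment ℝ (a : ℂ) b :=
    mem_openSegment_of_ne_left_right (fun h => ha (Subtype.ext h.symm))
      (fun h => hb (Subtype.ext h.symm)) hv
  obtain ⟨w, hw⟩ := exists_adj v
  refine Set.disjoint_left.1 (D.embedded a b v w h hw ?_) hv' (left_mem_segment ℝ _ _)
  intro he
  rcases Sym2.eq_iff.1 he with ⟨h1, -⟩ | ⟨-, h1⟩
  · exact ha h1.symm
  · exact hb h1.symm

/-- A small circle around a vertex meets exactly the segments that end there. -/
theorem exists_small_radius (v : D.V) : ∃ R : ℝ, 0 < R ∧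
    (∀ d : D.G.Dart, d.fst = v → R < ‖(d.snd : ℂ) - v‖) ∧
    ∀ d : D.G.Dart, d.fst ≠ v → d.snd ≠ v → ∀ θ,
      circleMap (v : ℂ) R θ ∉ segment ℝ (d.fst : ℂ) d.snd := by
  have h1 : ∀ d : D.G.Dart, ∀ᶠ R : ℝ in 𝓝[>] 0, d.fst = v → R < ‖(d.snd : ℂ) - v‖ := by
    intro d
    rw [eventually_imp_distrib_left]
    rintro rfl
    refine mem_nhdsWithin_of_mem_nhds (isOpen_Iio.mem_nhds ?_)
    exact norm_pos_iff.2 (sub_ne_zero.2 (ne_of_adj d.adj).symm)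
  have h2 : ∀ d : D.G.Dart, ∀ᶠ R : ℝ in 𝓝[>] 0, d.fst ≠ v → d.snd ≠ v → ∀ θ,
      circleMap (v : ℂ) R θ ∉ segment ℝ (d.fst : ℂ) d.snd := by
    intro d
    rw [eventually_imp_distrib_left]
    intro hf
    rw [eventually_imp_distrib_left]
    intro hs
    obtain ⟨ε, hε, hball⟩ := Metric.isOpen_iff.1 (isClosed_segment (d.fst : ℂ) d.snd).isOpen_compl
      v (vertex_notMem_segment d.adj hf.symm hs.symm)
    filter_upwards [Ioo_mem_nhdsGT hε] with R hR θ
    apply hball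
    rw [Metric.mem_ball, dist_eq_norm, circleMap_sub_center, norm_circleMap_zero, abs_of_pos hR.1]
    exact hR.2
  obtain ⟨R, ⟨h3, h4⟩, h5⟩ := (((eventually_all.2 h1).and (eventually_all.2 h2)).and
    self_mem_nhdsWithin).exists
  exact ⟨R, h5, h3, h4⟩

open Classical in
/-- The other end of an edge at `v`. -/
def otherEnd (v : D.V) (e : D.G.edgeSet) : D.V := if D.G.src e = v then D.G.tgt e else D.G.src e

theorem otherEnd_spec {v : D.V} {e : D.G.edgeSet} (h : v = D.G.src e ∨ v = D.G.tgt e) :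
    s(v, otherEnd v e) = (e : Sym2 D.V) := by
  unfold otherEnd
  by_cases h1 : D.G.src e = v
  · rw [if_pos h1, ← h1, D.G.mk_src_tgt]
  · rw [if_neg h1, h.resolve_left fun h => h1 h.symm, Sym2.eq_swap, D.G.mk_src_tgt]

theorem orientedInc_zmod_two (v : D.V) (e : D.G.edgeSet) :
    (D.G.orientedInc (ZMod 2) e v = 1 ∧ (v = D.G.src e ∨ v = D.G.tgt e)) ∨
      D.G.orientedInc (ZMod 2) e v = 0 := by
  have hne := (D.G.adj_src_tgt e).ne
  simp only [SimpleGraph.orientedInc, Matrix.of_apply]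
  by_cases h1 : v = D.G.src e
  · have h2 : v ≠ D.G.tgt e := by rw [h1]; exact hne
    rw [if_pos h1, if_neg h2]
    exact Or.inl ⟨by decide, Or.inl h1⟩
  · by_cases h2 : v = D.G.tgt e
    · rw [if_pos h2, if_neg h1]
      exact Or.inl ⟨by decide, Or.inr h2⟩
    · rw [if_neg h1, if_neg h2]
      exact Or.inr (by decide)

/-- The sum of the jumps around a vertex vanishes. -/
theorem LocConstOff.sum_jump_eq_zero {f : ℂ → ZMod 2} (hf : D.LocConstOff f) (v : D.V) :
    ∑ e, D.G.orientedInc (ZMod 2) e v * jump f e = 0 := by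
  classical
  obtain ⟨R, hR, hinc, hnon⟩ := exists_small_radius v
  have hpi := Real.pi_pos
  let γ : ℝ → ℂ := circleMap (v : ℂ) R
  have hγ : Continuous γ := continuous_circleMap _ _
  let u : D.G.edgeSet → ℝ → ℝ := fun e => turns (v : ℂ) (otherEnd v e)
  have hu : ∀ e, Continuous (u e) := fun e => continuous_turns _ _
  -- Each floor counts passages of the small circle through one edge. Subtracting the jumps they
  -- account for leaves a function that is constant wherever `γ` is off the diagram.
  let h : ℝ → ZMod 2 := fun θ =>
    f (γ θ) - ∑ e, D.G.orientedInc (ZMod 2) e v * jump f e * (⌊u e θ⌋ : ZMod 2)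
  have hedge : ∀ d : D.G.Dart, d.fst = v → otherEnd v (seg d) = d.snd := by
    rintro d rfl
    have h1 : s(D.G.src (seg d), D.G.tgt (seg d)) = s(d.fst, d.snd) := D.G.mk_src_tgt (seg d)
    have h2 : d.fst = D.G.src (seg d) ∨ d.fst = D.G.tgt (seg d) := by
      rcases Sym2.eq_iff.1 h1 with ⟨h3, -⟩ | ⟨-, h3⟩
      · exact Or.inl h3.symm
      · exact Or.inr h3.symm
    have h3 : s(d.fst, otherEnd d.fst (seg d)) = s(d.fst, d.snd) := otherEnd_spec h2
    exact Sym2.congr_right.1 h3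
  have hmem : ∀ d : D.G.Dart, d.fst = v → ∀ θ,
      γ θ ∈ segment ℝ (v : ℂ) d.snd ↔ ∃ n : ℤ, u (seg d) θ = n := by
    intro d hd θ
    simp only [u, hedge d hd]
    refine circleMap_mem_segment_iff ?_ hR (hinc d hd) θ
    rw [← hd]
    exact ne_of_adj d.adj
  have hfloor : ∀ e : D.G.edgeSet, ∀ θ : ℝ,
      (∀ d : D.G.Dart, seg d = e → γ θ ∉ segment ℝ (d.fst : ℂ) d.snd) →
      ∀ᶠ θ' in 𝓝 θ, D.G.orientedInc (ZMod 2) e v * jump f e * (⌊u e θ'⌋ : ZMod 2) =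
        D.G.orientedInc (ZMod 2) e v * jump f e * (⌊u e θ⌋ : ZMod 2) := by
    intro e θ he
    rcases orientedInc_zmod_two v e with ⟨-, h1⟩ | h1
    · have hs := otherEnd_spec h1
      have hadj : D.G.Adj v (otherEnd v e) := by
        rw [← SimpleGraph.mem_edgeSet, hs]
        exact e.2
      let d : D.G.Dart := ⟨(v, otherEnd v e), hadj⟩
      have hd : seg d = e := Subtype.ext hs
      have h2 := he d hd
      have h3 : ¬ ∃ n : ℤ, u e θ = n := by
        rw [← hd, ← hmem d rfl]
        exact h2
      push Not at h3
      filter_upwards [(hu e).continuousAt.eventually (eventually_floor_eq_of_forall_ne h3)]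
        with θ' h4
      rw [h4]
    · simp [h1]
  have hdart : ∀ θ, γ θ ∈ D.carrier → ∃ d : D.G.Dart, d.fst = v ∧
      γ θ ∈ openSegment ℝ (d.fst : ℂ) d.snd := by
    intro θ hθ
    obtain ⟨a, b, hab, hz⟩ := hθ
    have key : ∀ d : D.G.Dart, d.fst = v → γ θ ∈ segment ℝ (d.fst : ℂ) d.snd →
        γ θ ∈ openSegment ℝ (d.fst : ℂ) d.snd := by
      rintro d rfl hz
      have hn : ‖γ θ - d.fst‖ = R := by
        simp only [γ]
        rw [circleMap_sub_center, norm_circleMap_zero, abs_of_pos hR]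
      refine mem_openSegment_of_ne_left_right ?_ ?_ hz
      · intro h'
        rw [← h', sub_self, norm_zero] at hn
        exact hR.ne hn
      · intro h'
        rw [← h'] at hn
        exact (hinc d rfl).ne' hn
    by_cases ha : a = v
    · exact ⟨⟨(a, b), hab⟩, ha, key _ ha hz⟩
    · by_cases hb : b = v
      · exact ⟨⟨(b, a), hab.symm⟩, hb, key ⟨(b, a), hab.symm⟩ hb (by rwa [segment_symm])⟩
      · exact absurd hz (hnon ⟨(a, b), hab⟩ ha hb θ)
  let T : Set ℝ := {θ | γ θ ∉ D.carrier}
  -- The circle meets the diagram only in countably many angles.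
  have hT : Dense T := by
    have hcount : (⋃ d : D.G.Dart, ⋃ n : ℤ,
        ({((d.snd : ℂ) - v).arg + n * (2 * Real.pi)} : Set ℝ)).Countable :=
      Set.countable_iUnion fun d => Set.countable_iUnion fun n => Set.countable_singleton _
    refine (hcount.dense_compl ℝ).mono ?_
    intro θ hθ hγθ
    apply hθ
    obtain ⟨d, hd, hz⟩ := hdart θ hγθ
    rw [hd] at hz
    obtain ⟨n, hn⟩ := (hmem d hd θ).1 (openSegment_subset_segment ℝ _ _ hz)
    refine Set.mem_iUnion.2 ⟨d, Set.mem_iUnion.2 ⟨n, ?_⟩⟩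
    simp only [u, hedge d hd, turns] at hn
    rw [div_eq_iff (by positivity)] at hn
    rw [Set.mem_singleton_iff]
    linarith
  have hconst : ∀ θ, ∃ c, ∀ᶠ θ' in 𝓝[T] θ, h θ' = c := by
    intro θ
    by_cases hθ : γ θ ∈ D.carrier
    · obtain ⟨d, hd, hz⟩ := hdart θ hθ
      have hother : ∀ e ∈ Finset.univ.erase (seg d),
          ∀ᶠ θ' in 𝓝 θ, D.G.orientedInc (ZMod 2) e v * jump f e * (⌊u e θ'⌋ : ZMod 2) =
            D.G.orientedInc (ZMod 2) e v * jump f e * (⌊u e θ⌋ : ZMod 2) := by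
        intro e he
        refine hfloor e θ fun d' hd' => ?_
        refine (eventually_notMem_other_segments d.adj hz).self_of_nhds d' ?_
        intro h'
        refine Finset.ne_of_mem_erase he (hd'.symm.trans (Subtype.ext ?_))
        exact h'.symm
      have hz' := hz
      rw [hd] at hz'
      obtain ⟨n, hn⟩ := (hmem d hd θ).1 (openSegment_subset_segment ℝ _ _ hz')
      have hone : D.G.orientedInc (ZMod 2) (seg d) v = 1 := by
        have h1 : s(D.G.src (seg d), D.G.tgt (seg d)) = s(d.fst, d.snd) := D.G.mk_src_tgt (seg d)
        have hne := d.adj.ne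
        rw [hd] at h1 hne
        rcases Sym2.eq_iff.1 h1 with ⟨h3, h4⟩ | ⟨h3, h4⟩ <;>
          simp [SimpleGraph.orientedInc, h3, h4, hne]
      refine ⟨leftValue f d - (jump f (seg d) * (n : ZMod 2) +
        ∑ e ∈ Finset.univ.erase (seg d),
          D.G.orientedInc (ZMod 2) e v * jump f e * (⌊u e θ⌋ : ZMod 2)), ?_⟩
      have hnear : ∀ᶠ θ' in 𝓝 θ, |u (seg d) θ' - n| < 1 := by
        have h1 : ContinuousAt (fun θ' => |u (seg d) θ' - n|) θ :=
          ((hu _).continuousAt.sub continuousAt_const).abs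
        refine h1.eventually_lt_const ?_
        simp [hn]
      have hpi' : ∀ᶠ θ' in 𝓝 θ, |θ' - θ| < Real.pi := by
        have h1 : ContinuousAt (fun θ' => |θ' - θ|) θ := by fun_prop
        refine h1.eventually_lt_const ?_
        simpa using hpi
      filter_upwards [mem_nhdsWithin_of_mem_nhds ((Finset.eventually_all _).2 hother),
        mem_nhdsWithin_of_mem_nhds hnear, mem_nhdsWithin_of_mem_nhds hpi',
        mem_nhdsWithin_of_mem_nhds (hγ.continuousAt.eventually (hf.eventually_side d hz)),
        self_mem_nhdsWithin] with θ' h1 h2 h3 h4 h5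
      have hdiff : u (seg d) θ' = n + (θ' - θ) / (2 * Real.pi) := by
        rw [← hn]
        simp only [u, turns]
        ring
      have harg : θ - ((d.snd : ℂ) - d.fst).arg = n * (2 * Real.pi) := by
        have h6 := hn
        simp only [u, hedge d hd, turns] at h6
        rw [div_eq_iff (by positivity)] at h6
        rw [hd]
        exact h6
      have him : (segCoord (d.fst : ℂ) d.snd (γ θ')).im =
          R / ‖(d.snd : ℂ) - d.fst‖ * Real.sin (θ' - θ) := by
        have h6 := segCoord_circleMap_im (ne_of_adj d.adj) R θ'
        rw [hd] at h6 harg ⊢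
        rw [h6]
        congr 1
        rw [show θ' - ((d.snd : ℂ) - v).arg = θ' - θ + n * (2 * Real.pi) by linarith]
        exact Real.sin_add_int_mul_two_pi _ _
      have hRpos : 0 < R / ‖(d.snd : ℂ) - d.fst‖ :=
        div_pos hR (norm_pos_iff.2 (sub_ne_zero.2 (ne_of_adj d.adj).symm))
      have hne : θ' ≠ θ := by
        rintro rfl
        exact h5 hθ
      rw [abs_lt] at h3
      simp only [h]
      rw [← Finset.add_sum_erase _ _ (Finset.mem_univ (seg d)), Finset.sum_congr rfl h1, hone,
        one_mul]
      -- Just before the edge the value is the right one and the floor is `n - 1`; just after it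
      -- they are the left one and `n`. The change is the jump, as signs do not matter mod 2.
      rcases lt_or_gt_of_ne hne with hlt | hgt
      · have hsin : Real.sin (θ' - θ) < 0 :=
          Real.sin_neg_of_neg_of_neg_pi_lt (by linarith) (by linarith)
        rw [h4.2 (by rw [him]; exact mul_neg_of_pos_of_neg hRpos hsin),
          (floor_eq_of_near_int h2).2 (by
            rw [hdiff]
            have : (θ' - θ) / (2 * Real.pi) < 0 := div_neg_of_neg_of_pos (by linarith) (by linarith)
            linarith), jump_seg]
        push_cast
        linear_combination zmod_two_add_self (leftValue f d.symm)
      · have hsin : 0 < Real.sin (θ' - θ) := Real.sin_pos_of_pos_of_lt_pi (by linarith) (by linarith)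
        rw [h4.1 (by rw [him]; exact mul_pos hRpos hsin),
          (floor_eq_of_near_int h2).1 (by
            rw [hdiff]
            have : 0 < (θ' - θ) / (2 * Real.pi) := div_pos (by linarith) (by linarith)
            linarith)]
    · refine ⟨h θ, mem_nhdsWithin_of_mem_nhds ?_⟩
      have h1 := hγ.continuousAt.eventually (hf _ hθ)
      have h2 := (eventually_all (ι := D.G.edgeSet)).2 fun e => hfloor e θ fun d _ hz =>
        hθ (segment_subset_carrier d.adj hz)
      filter_upwards [h1, h2] with θ' h1 h2
      simp only [h]
      rw [h1, Finset.sum_congr rfl fun e _ => h2 e]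
  obtain ⟨c, hc⟩ := (isPreconnected_univ (α := ℝ)).exists_eventually_eq (T := T) (f := h)
    (by rw [hT.closure_eq]) fun θ _ => hconst θ
  obtain ⟨θ, hθ⟩ := hT.nonempty
  have hper : γ (θ + 2 * Real.pi) = γ θ := circleMap_add_two_pi _ _ _
  have hθ' : θ + 2 * Real.pi ∈ T := by
    change γ (θ + 2 * Real.pi) ∉ D.carrier
    rw [hper]
    exact hθ
  have h1 := (hc θ trivial).self_of_nhdsWithin hθ
  have h2 := (hc (θ + 2 * Real.pi) trivial).self_of_nhdsWithin hθ'
  -- A full turn returns `f` to its value and raises every floor by one, so constancy of `h` makes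
  -- the sum of the jumps vanish.
  have h3 : h (θ + 2 * Real.pi) = h θ - ∑ e, D.G.orientedInc (ZMod 2) e v * jump f e := by
    simp only [h, hper, u, turns_add_two_pi, Int.floor_add_one]
    push_cast
    simp only [mul_add, mul_one, Finset.sum_add_distrib]
    ring
  rw [h1, h2] at h3
  linear_combination h3

theorem exists_injective_jump : ∃ φ : (D.interiorFaces → ZMod 2) →ₗ[ZMod 2] (D.G.cycleSpace (ZMod 2)),
    Function.Injective φ := by
  have hadd : ∀ h h' : D.interiorFaces → ZMod 2, faceFun (h + h') = faceFun h + faceFun h' := by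
    intro h h'
    ext p
    simp only [faceFun, Pi.add_apply]
    split_ifs <;> simp
  let ψ : (D.interiorFaces → ZMod 2) →+ D.G.cycleSpace (ZMod 2) := AddMonoidHom.mk'
    (fun h => ⟨jump (faceFun h),
      (D.G.mem_cycleSpace).2 fun v => (locConstOff_faceFun h).sum_jump_eq_zero v⟩)
    (fun h h' => by
      ext e
      simp only [hadd]
      exact jump_add (locConstOff_faceFun h) (locConstOff_faceFun h') e)
  refine ⟨ψ.toZModLinearMap 2, ?_⟩
  rw [← LinearMap.ker_eq_bot, LinearMap.ker_eq_bot']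
  intro h hh
  have hj : ∀ e : D.G.edgeSet, jump (faceFun h) e = 0 := fun e =>
    congrFun (congrArg Subtype.val hh) e
  ext F
  obtain ⟨p, hp⟩ := face_nonempty F.2.1
  rw [← faceFun_of_mem h F hp]
  exact (locConstOff_faceFun h).eq_zero_of_jump hj (fun q _ hq => faceFun_eq_zero h hq)
    (face_subset F.2.1 hp).2

/-- The injection of `exists_injective_jump` requires no finiteness of the faces, and its target is
a finite set. -/
theorem finite_interiorFaces : D.interiorFaces.Finite := by
  obtain ⟨φ, hφ⟩ := exists_injective_jump (D := D)
  have : Finite (D.interiorFaces → ZMod 2) := Finite.of_injective φ hφ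
  classical
  have hinj : Function.Injective fun F : D.interiorFaces => (Pi.single F 1 : D.interiorFaces → ZMod 2) := by
    intro F F' h
    by_contra hne
    have := congrFun h F
    simp [Pi.single_eq_of_ne hne] at this
  exact Finite.of_injective _ hinj

theorem numInteriorFaces_le_finrank :
    D.numInteriorFaces ≤ finrank (ZMod 2) (D.G.cycleSpace (ZMod 2)) := by
  obtain ⟨φ, hφ⟩ := exists_injective_jump (D := D)
  have := (finite_interiorFaces (D := D)).fintype
  have h1 := LinearMap.finrank_le_finrank_of_injective hφ
  rwa [finrank_fintype_fun_eq_card, ← Nat.card_eq_fintype_card, Nat.card_coe_set_eq] at h1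

/-- Euler's formula for the number of interior faces. -/
theorem numInteriorFaces_add_card : D.numInteriorFaces + D.V.card =
    Fintype.card D.G.edgeSet + D.numComponents := by
  -- The upper bound comes from `ZMod 2` and the lower bound from `ℂ`; the two cycle spaces have the
  -- same dimension.
  have h1 := numInteriorFaces_le_finrank (D := D)
  have h2 := finrank_cycleSpace_le_numInteriorFaces (finite_interiorFaces (D := D))
  have h3 := D.G.finrank_cycleSpace (K := ZMod 2)
  have h4 := D.G.finrank_cycleSpace (K := ℂ)
  rw [Fintype.card_coe] at h3 h4
  rw [numComponents]
  omega

end TangleDiagram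

end

/-! ### Exponents of the state sum and the span bound -/

noncomputable section

open Module

/-- The Laurent polynomials with exponents between `a` and `b`. -/
def laurentBetween (a b : ℤ) : Submodule ℤ (LaurentPolynomial ℤ) :=
  Submodule.span ℤ (LaurentPolynomial.T '' Set.Icc a b)

theorem T_mem_laurentBetween {a b k : ℤ} (ha : a ≤ k) (hb : k ≤ b) :
    LaurentPolynomial.T k ∈ laurentBetween a b := Submodule.subset_span ⟨k, ⟨ha, hb⟩, rfl⟩

theorem mul_mem_laurentBetween {a b c d : ℤ} {p q : LaurentPolynomial ℤ}
    (hp : p ∈ laurentBetween a b) (hq : q ∈ laurentBetween c d) :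
    p * q ∈ laurentBetween (a + c) (b + d) := by
  have h := Submodule.mul_mem_mul hp hq
  rw [laurentBetween, laurentBetween, Submodule.span_mul_span] at h
  refine Submodule.span_mono ?_ h
  rintro _ ⟨_, ⟨k, hk, rfl⟩, _, ⟨l, hl, rfl⟩, rfl⟩
  exact ⟨k + l, ⟨add_le_add hk.1 hl.1, add_le_add hk.2 hl.2⟩, LaurentPolynomial.T_add k l⟩

theorem pow_mem_laurentBetween {a b : ℤ} {p : LaurentPolynomial ℤ}
    (hp : p ∈ laurentBetween a b) (n : ℕ) : p ^ n ∈ laurentBetween (n * a) (n * b) := by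
  induction n with
  | zero =>
    rw [pow_zero, ← LaurentPolynomial.T_zero]
    exact T_mem_laurentBetween (by simp) (by simp)
  | succ n ih =>
    rw [pow_succ]
    have h := mul_mem_laurentBetween ih hp
    convert h using 2 <;> push_cast <;> ring

theorem bounds_of_mem_laurentBetween {a b : ℤ} {p : LaurentPolynomial ℤ}
    (hp : p ∈ laurentBetween a b) {k : ℤ} (hk : p.coeff k ≠ 0) : a ≤ k ∧ k ≤ b := by
  by_contra hn
  apply hk
  refine Submodule.span_induction (p := fun p _ => p.coeff k = 0) ?_ ?_ ?_ ?_ hp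
  · rintro _ ⟨l, hl, rfl⟩
    rw [LaurentPolynomial.T_apply, if_neg]
    rintro rfl
    exact hn hl
  · rfl
  · intro x y _ _ hx hy
    rw [AddMonoidAlgebra.coeff_add, Finsupp.add_apply, hx, hy, add_zero]
  · intro c x _ hx
    rw [AddMonoidAlgebra.coeff_smul, Finsupp.smul_apply, hx, smul_zero]

theorem laurentSpan_le {p : LaurentPolynomial ℤ} {m : ℤ} (hm : 0 ≤ m)
    (h : ∀ k l, p.coeff k ≠ 0 → p.coeff l ≠ 0 → k - l ≤ m) : laurentSpan p ≤ m := by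
  unfold laurentSpan
  split_ifs with hs
  · exact h _ _ (Finsupp.mem_support_iff.1 (Finset.max'_mem _ hs))
      (Finsupp.mem_support_iff.1 (Finset.min'_mem _ hs))
  · exact hm

namespace TangleDiagram

variable {D : TangleDiagram}

/-- Every crossing contributes `1` or `-1`, so only differing crossings matter, each by at most `2`.
-/
theorem stateExponent_sub_le (s s' : D.State) : D.stateExponent s - D.stateExponent s' ≤
    2 * Nat.card {x : D.Crossing // s x ≠ s' x} := by
  classical
  have key : ∀ s : D.State, D.stateExponent s = ∑ x, if s x = true then (1 : ℤ) else -1 := by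
    intro s
    rw [stateExponent, Nat.card_eq_fintype_card, Nat.card_eq_fintype_card, Fintype.card_subtype,
      Fintype.card_subtype, Finset.card_filter, Finset.card_filter]
    push_cast
    rw [← Finset.sum_sub_distrib]
    refine Finset.sum_congr rfl fun x _ => ?_
    cases s x <;> simp
  rw [key, key, Nat.card_eq_fintype_card, Fintype.card_subtype, Finset.card_filter,
    ← Finset.sum_sub_distrib]
  push_cast
  rw [Finset.mul_sum]
  refine Finset.sum_le_sum fun x _ => ?_
  cases s x <;> cases s' x <;> simp

/-- An exponent of the sum must occur in the term of some state, whatever cancels. Only the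
exponents of `δ` enter, so both brackets are covered. -/
theorem exists_state_of_coeff_ne_zero {δ : LaurentPolynomial ℤ} (hδ : δ ∈ laurentBetween (-2) 2)
    {B : TangleDiagram} {k : ℤ} (hk : (D.skeinCoeff δ B).coeff k ≠ 0) :
    ∃ s : D.State, D.SmoothsTo s B ∧ D.stateExponent s - 2 * D.numLoops s ≤ k ∧
      k ≤ D.stateExponent s + 2 * D.numLoops s := by
  classical
  rw [skeinCoeff, AddMonoidAlgebra.coeff_sum, Finsupp.finsetSum_apply] at hk
  obtain ⟨s, -, hs⟩ := Finset.exists_ne_zero_of_sum_ne_zero hk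
  by_cases h : D.SmoothsTo s B
  · rw [if_pos h] at hs
    have h1 := bounds_of_mem_laurentBetween (mul_mem_laurentBetween
      (T_mem_laurentBetween le_rfl le_rfl) (pow_mem_laurentBetween hδ (D.numLoops s))) hs
    exact ⟨s, h, by linarith [h1.1], by linarith [h1.2]⟩
  · rw [if_neg h] at hs
    exact absurd rfl hs

theorem laurentSpan_skeinCoeff_le {δ : LaurentPolynomial ℤ} (hδ : δ ∈ laurentBetween (-2) 2)
    (B : TangleDiagram) (hi : (4 * D.numInteriorFaces : ℤ) =
        4 * ((D.numCrossings : ℤ) + D.numComponents) - 2 * D.numBoundary) :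
    laurentSpan (D.skeinCoeff δ B) ≤ 4 * D.numInteriorFaces := by
  refine laurentSpan_le (by positivity) fun k l hk hl => ?_
  obtain ⟨s, hs, -, h1⟩ := exists_state_of_coeff_ne_zero hδ hk
  obtain ⟨s', hs', h2, -⟩ := exists_state_of_coeff_ne_zero hδ hl
  have h3 := numLoops_add_numLoops_le s s' fun p hp q hq =>
    (hs p hp q hq).trans (hs' p hp q hq).symm
  have h4 := stateExponent_sub_le s s'
  -- With `d` differing crossings and `l₁`, `l₂` loops, `k - l ≤ 2d + 2l₁ + 2l₂ ≤ 4(n + c) - 2g`.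
  omega

/-- Handshake count: a bend has degree `2`, a crossing two more, a boundary point one less. -/
theorem two_mul_card_edgeSet : 2 * (Fintype.card D.G.edgeSet : ℤ) =
    2 * D.V.card + 2 * D.numCrossings - D.numBoundary := by
  classical
  have h1 := D.G.sum_degrees_eq_twice_card_edges
  have hE : ∀ _ : Fintype D.G.edgeSet, D.G.edgeFinset.card = Nat.card D.G.edgeSet := by
    intro _
    rw [Nat.card_coe_set_eq, ← Set.ncard_coe_finset, SimpleGraph.coe_edgeFinset]
  rw [hE, Nat.card_eq_fintype_card] at h1
  have h2 : ∀ v : D.V, (D.G.degree v : ℤ) = 2 + 2 * (if (D.G.neighborSet v).ncard = 4 then 1 else 0)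
      - (if ‖(v : ℂ)‖ = 1 then 1 else 0) := by
    intro v
    have hd : D.G.degree v = (D.G.neighborSet v).ncard := by
      rw [Set.ncard_eq_toFinset_card', ← SimpleGraph.card_neighborSet_eq_degree, Set.toFinset_card]
    rw [hd]
    by_cases h : ‖(v : ℂ)‖ = 1
    · rw [D.boundary_valence v h, if_pos h]
      norm_num
    · rw [if_neg h]
      rcases D.interior_valence v ((D.norm_le v).lt_of_ne h) with h' | h' <;> rw [h'] <;> norm_num
  have h3 : D.numCrossings = Finset.card (Finset.univ.filter fun v : D.V =>
      (D.G.neighborSet v).ncard = 4) := by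
    rw [numCrossings, Nat.card_eq_fintype_card, Fintype.card_subtype]
  have h4 : D.numBoundary = Finset.card (Finset.univ.filter fun v : D.V => ‖(v : ℂ)‖ = 1) := by
    rw [numBoundary, ← Set.ncard_coe_finset, ← Set.ncard_image_of_injective _ Subtype.val_injective]
    congr 1
    ext z
    simp [boundary, and_comm]
  have h5 : (∑ v : D.V, (D.G.degree v : ℤ)) = 2 * Fintype.card D.G.edgeSet := by
    exact_mod_cast h1
  rw [← h5, Finset.sum_congr rfl fun v _ => h2 v, Finset.sum_sub_distrib, Finset.sum_add_distrib,
    ← Finset.mul_sum, h3, h4, Finset.card_filter, Finset.card_filter]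
  push_cast
  simp [mul_comm]

/-- The number of interior faces in terms of crossings, components and boundary points. -/
theorem four_mul_numInteriorFaces : (4 * D.numInteriorFaces : ℤ) =
    4 * ((D.numCrossings : ℤ) + D.numComponents) - 2 * D.numBoundary := by
  have h1 := numInteriorFaces_add_card (D := D)
  have h2 := two_mul_card_edgeSet (D := D)
  omega

end TangleDiagram

end

theorem mainTheorem3 (D : TangleDiagram) :
    (4 * D.numInteriorFaces : ℤ) =
        4 * ((D.numCrossings : ℤ) + D.numComponents) - 2 * D.numBoundary ∧
      ∀ B : TangleDiagram, B.IsBase → B.boundary = D.boundary →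
        laurentSpan (D.posBracketCoeff B) ≤ 4 * D.numInteriorFaces ∧
        laurentSpan (D.bracketCoeff B) ≤ 4 * D.numInteriorFaces := by
  have h2 : LaurentPolynomial.T 2 ∈ laurentBetween (-2) 2 :=
    T_mem_laurentBetween (by norm_num) le_rfl
  have h2' : LaurentPolynomial.T (-2) ∈ laurentBetween (-2) 2 :=
    T_mem_laurentBetween le_rfl (by norm_num)
  refine ⟨TangleDiagram.four_mul_numInteriorFaces, fun B _ _ => ⟨?_, ?_⟩⟩
  · exact TangleDiagram.laurentSpan_skeinCoeff_le (Submodule.add_mem _ h2 h2') B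
      TangleDiagram.four_mul_numInteriorFaces
  · exact TangleDiagram.laurentSpan_skeinCoeff_le
      (Submodule.sub_mem _ (Submodule.neg_mem _ h2) h2') B TangleDiagram.four_mul_numInteriorFaces
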